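/- Let $G=(V,E)$ be a finite simple undirected graph and let $\phi\colon V\to\mathbb{N}$ be a demand function (with no bound on the demands). A set $S\subseteq V$ is a \emph{vector connectivity set} for $(G,\phi)$ if every vertex $v\in V\setminus S$ has $\phi(v)$ paths in $G$ from $v$ to vertices of $S$ that are pairwise vertex-disjoint except for sharing $v$. Let $\mathrm{opt}(G,\phi)$ denote the minimum size of a vector connectivity set for $(G,\phi)$. \textbf{Corollary.} There is a polynomial-time algorithm that, given any pair $(G,\phi)$ as above, returns a vector connectivity set for $(G,\phi)$ of size at most $\mathrm{opt}(G,\phi)^2$. Here the graph is given by its adjacency matrix on the vertices $0,\dots,n-1$. The running time is the number of steps of a random access machine with unit-cost addition, truncated subtraction, zero test and indirect addressing (no multiplication), and it is bounded by a polynomial in the size $n^2+\sum_{v}\operatorname{bits}(\phi(v))$ of the input, where $\operatorname{bits}(m)$ is the length of $m$ in binary. -/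

import Mathlib

namespace VectorConn

/-! ## Vector connectivity -/

/-- `v` has `k` paths in `G` with endpoints in `S` that are vertex-disjoint except for sharing `v`.
(Only used for `v ∉ S`; then all these paths are nontrivial and have distinct endpoints.) -/
def HasDisjointPaths {V : Type*} (G : SimpleGraph V) (v : V) (S : Finset V) (k : ℕ) : Prop :=
  ∃ (t : Fin k → V) (P : ∀ i, G.Path v (t i)),
    (∀ i, t i ∈ S) ∧
    ∀ i j, i ≠ j → ∀ w, w ∈ (P i).1.support → w ∈ (P j).1.support → w = v

/-- `S` is a vector connectivity set for `(G, φ)`: every vertex `v` outside `S` has `φ v`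
vertex-disjoint paths (sharing only `v`) with endpoints in `S`. -/
def IsVectorConnectivitySet {V : Type*} (G : SimpleGraph V) (φ : V → ℕ) (S : Finset V) : Prop :=
  ∀ v, v ∉ S → HasDisjointPaths G v S (φ v)

/-- The minimum size of a vector connectivity set for `(G, φ)`. -/
noncomputable def opt {V : Type*} (G : SimpleGraph V) (φ : V → ℕ) : ℕ :=
  sInf {k | ∃ S : Finset V, IsVectorConnectivitySet G φ S ∧ S.card = k}

theorem isVectorConnectivitySet_univ {V : Type*} [Fintype V] (G : SimpleGraph V) (φ : V → ℕ) :
    IsVectorConnectivitySet G φ Finset.univ :=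
  fun v hv => absurd (Finset.mem_univ v) hv

/-- On a finite graph the optimum is attained, so the infimum is a genuine minimum. -/
theorem exists_card_eq_opt {V : Type*} [Fintype V] (G : SimpleGraph V) (φ : V → ℕ) :
    ∃ S : Finset V, IsVectorConnectivitySet G φ S ∧ S.card = opt G φ :=
  Nat.sInf_mem (s := {k | ∃ S : Finset V, IsVectorConnectivitySet G φ S ∧ S.card = k})
    ⟨_, Finset.univ, isVectorConnectivitySet_univ G φ, rfl⟩

/-! ## The machine model

A random access machine programmed in structured form. It has registers and arrays, all holding
natural numbers; a program mentions finitely many of them by fixed names, while array indices are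
computed (indirect addressing). The arithmetic operations are addition and truncated subtraction.
There is no multiplication, so a number computed in `t` steps has at most `O(t)` more bits than the
numbers in the program and the input, and polynomially many unit-cost steps of this machine are
polynomial time in the Turing machine sense. -/

/-- Register contents and array contents: `arr a i` is cell `i` of array `a`. -/
structure State where
  reg : ℕ → ℕ
  arr : ℕ → ℕ → ℕ

/-- Expressions. -/
inductive Expr where
  | const (c : ℕ)
  | var (x : ℕ)
  | load (a : ℕ) (i : Expr)
  | add (e₁ e₂ : Expr)
  | sub (e₁ e₂ : Expr)

/-- The value of an expression. -/
def Expr.eval (s : State) : Expr → ℕ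
  | .const c => c
  | .var x => s.reg x
  | .load a i => s.arr a (i.eval s)
  | .add e₁ e₂ => e₁.eval s + e₂.eval s
  | .sub e₁ e₂ => e₁.eval s - e₂.eval s

/-- The number of steps for evaluating an expression: one for each operation and operand. -/
def Expr.cost : Expr → ℕ
  | .const _ => 1
  | .var _ => 1
  | .load _ i => i.cost + 1
  | .add e₁ e₂ => e₁.cost + e₂.cost + 1
  | .sub e₁ e₂ => e₁.cost + e₂.cost + 1

/-- Programs. A condition `e` counts as true if and only if its value is nonzero. -/
inductive Prog where
  | skip
  | assign (x : ℕ) (e : Expr)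
  | store (a : ℕ) (i e : Expr)
  | seq (p q : Prog)
  | cond (e : Expr) (p q : Prog)
  | loop (e : Expr) (p : Prog)

/-- The state with register `x` set to `c`. -/
def State.setReg (s : State) (x c : ℕ) : State :=
  { s with reg := Function.update s.reg x c }

/-- The state with cell `i` of array `a` set to `c`. -/
def State.setArr (s : State) (a i c : ℕ) : State :=
  { s with arr := Function.update s.arr a (Function.update (s.arr a) i c) }

/-- `Exec p s t s'`: started in state `s`, the program `p` halts after exactly `t` steps in
state `s'`. -/
inductive Exec : Prog → State → ℕ → State → Prop where
  | skip (s : State) : Exec .skip s 1 s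
  | assign (x : ℕ) (e : Expr) (s : State) :
      Exec (.assign x e) s (e.cost + 1) (s.setReg x (e.eval s))
  | store (a : ℕ) (i e : Expr) (s : State) :
      Exec (.store a i e) s (i.cost + e.cost + 1) (s.setArr a (i.eval s) (e.eval s))
  | seq {p q : Prog} {s s₁ s₂ : State} {t₁ t₂ : ℕ} :
      Exec p s t₁ s₁ → Exec q s₁ t₂ s₂ → Exec (.seq p q) s (t₁ + t₂) s₂
  | cond_true {e : Expr} {p q : Prog} {s s' : State} {t : ℕ} :
      e.eval s ≠ 0 → Exec p s t s' → Exec (.cond e p q) s (e.cost + 1 + t) s'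
  | cond_false {e : Expr} {p q : Prog} {s s' : State} {t : ℕ} :
      e.eval s = 0 → Exec q s t s' → Exec (.cond e p q) s (e.cost + 1 + t) s'
  | loop_true {e : Expr} {p : Prog} {s s₁ s₂ : State} {t₁ t₂ : ℕ} :
      e.eval s ≠ 0 → Exec p s t₁ s₁ → Exec (.loop e p) s₁ t₂ s₂ →
        Exec (.loop e p) s (e.cost + 1 + t₁ + t₂) s₂
  | loop_false {e : Expr} {p : Prog} {s : State} :
      e.eval s = 0 → Exec (.loop e p) s (e.cost + 1) s

/-- Programs are deterministic: final state and number of steps are determined by the start. -/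
theorem Exec.deterministic {p : Prog} {s s₁ s₂ : State} {t₁ t₂ : ℕ}
    (h₁ : Exec p s t₁ s₁) (h₂ : Exec p s t₂ s₂) : t₁ = t₂ ∧ s₁ = s₂ := by
  induction h₁ generalizing t₂ s₂ with
  | skip => cases h₂; exact ⟨rfl, rfl⟩
  | assign => cases h₂; exact ⟨rfl, rfl⟩
  | store => cases h₂; exact ⟨rfl, rfl⟩
  | seq _ _ ih ih' =>
    cases h₂ with
    | seq a b =>
      obtain ⟨rfl, rfl⟩ := ih a
      obtain ⟨rfl, rfl⟩ := ih' b
      exact ⟨rfl, rfl⟩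
  | cond_true h _ ih =>
    cases h₂ with
    | cond_true _ a => obtain ⟨rfl, rfl⟩ := ih a; exact ⟨rfl, rfl⟩
    | cond_false h' _ => exact absurd h' h
  | cond_false h _ ih =>
    cases h₂ with
    | cond_true h' _ => exact absurd h h'
    | cond_false _ a => obtain ⟨rfl, rfl⟩ := ih a; exact ⟨rfl, rfl⟩
  | loop_true h _ _ ih ih' =>
    cases h₂ with
    | loop_true _ a b =>
      obtain ⟨rfl, rfl⟩ := ih a
      obtain ⟨rfl, rfl⟩ := ih' b
      exact ⟨rfl, rfl⟩
    | loop_false h' => exact absurd h' h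
  | loop_false h =>
    cases h₂ with
    | loop_true h' _ _ => exact absurd h h'
    | loop_false _ => exact ⟨rfl, rfl⟩

/-! ## Input and output -/

open Classical in
/-- The start state on input `(G, φ)`, where `G` is a graph with vertices `0, …, n - 1`: register 0
holds `n`, array 0 the adjacency matrix of `G` in row-major order, array 1 the demands; everything
else is 0. -/
noncomputable def inputState {n : ℕ} (G : SimpleGraph (Fin n)) (φ : Fin n → ℕ) : State where
  reg x := if x = 0 then n else 0
  arr a i :=
    if a = 0 then (if ∃ u v : Fin n, i = u * n + v ∧ G.Adj u v then 1 else 0)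
    else if a = 1 then (if h : i < n then φ ⟨i, h⟩ else 0)
    else 0

/-- The size of the input in bits: the adjacency matrix and the demands in binary. -/
def inputSize {n : ℕ} (φ : Fin n → ℕ) : ℕ :=
  n * n + ∑ v, Nat.size (φ v)

/-- The set of vertices whose cell in the output array, array 2, is nonzero. -/
def outputSet (n : ℕ) (s : State) : Finset (Fin n) :=
  Finset.univ.filter fun v => s.arr 2 v ≠ 0

end VectorConn

/-! Call a set `X` disjoint from `S` violated if it contains a vertex whose demand exceeds the
number of neighbours of `X`. By Menger's theorem, `S` is a vector connectivity set exactly when no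
set is violated. For a guess `k`, start with the vertices of demand more than `k`; every solution of
size at most `k` contains them. While some set is violated, take an inclusion-minimal violated set
`X` and add to `S` its boundary together with one vertex of `X`. This adds at most `k` vertices,
since the boundary is smaller than some demand that is at most `k`. A later violated set avoids the
boundary of `X`, so by uncrossing (`Violated.inter_or_sdiff`) its part inside or its part outside
`X` is violated; the inside part would be all of `X` by minimality, but `X` is now hit. Hence the
chosen sets are pairwise disjoint (`Greedy.step`), and every solution of size at most `k` meets each
of them. If `m` sets arise and `m ≤ k`, then `S` has at most `k ^ 2` vertices; if `m > k`, then the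
optimum exceeds `k`. The first `k = 0, 1, …` with `m ≤ k` is therefore at most the optimum. A
minimal violated set is the complement of a maximal `T ⊇ S` that is not a vector connectivity set
(`violated_compl_of_maximal`), so a test for vector connectivity suffices to find it. The test is an
auction for a bipartite assignment. Complete assignments encode disjoint paths
(`Auction.hasDisjointPaths`), and a failed auction exhibits a violated set by a gap in the prices
(`Auction.exists_violated`). The hard half of Menger's theorem thus comes out of the auction. Prices
never exceed `n + 1`, so its length is polynomial in `n` whatever the demands are. -/

namespace VectorConn

/-! ## Reasoning about programs -/

/-- Started in `s`, the program `p` halts within `B` steps in a state satisfying `Q`. -/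
def Runs (p : Prog) (s : State) (B : ℕ) (Q : State → Prop) : Prop :=
  ∃ t s', Exec p s t s' ∧ t ≤ B ∧ Q s'

/-- The registers assigned by a program. -/
def Prog.regs : Prog → List ℕ
  | .skip => []
  | .assign x _ => [x]
  | .store _ _ _ => []
  | .seq p q => p.regs ++ q.regs
  | .cond _ p q => p.regs ++ q.regs
  | .loop _ p => p.regs

/-- The arrays written by a program. -/
def Prog.arrs : Prog → List ℕ
  | .skip => []
  | .assign _ _ => []
  | .store a _ _ => [a]
  | .seq p q => p.arrs ++ q.arrs
  | .cond _ p q => p.arrs ++ q.arrs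
  | .loop _ p => p.arrs

/-- The states `s` and `s'` agree outside what the program `p` writes. -/
structure Frame (p : Prog) (s s' : State) : Prop where
  reg : ∀ x, x ∉ p.regs → s'.reg x = s.reg x
  arr : ∀ a, a ∉ p.arrs → s'.arr a = s.arr a

@[simp] theorem setReg_reg (s : State) (x c y : ℕ) :
    (s.setReg x c).reg y = if y = x then c else s.reg y := by
  simp [State.setReg, Function.update_apply]

@[simp] theorem setReg_arr (s : State) (x c : ℕ) : (s.setReg x c).arr = s.arr := rfl

@[simp] theorem setArr_reg (s : State) (a i c : ℕ) : (s.setArr a i c).reg = s.reg := rfl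

theorem setArr_arr (s : State) (a i c b : ℕ) :
    (s.setArr a i c).arr b = if b = a then Function.update (s.arr a) i c else s.arr b := by
  simp [State.setArr, Function.update_apply]

theorem Frame.refl (p : Prog) (s : State) : Frame p s s := ⟨fun _ _ => rfl, fun _ _ => rfl⟩

theorem Frame.trans {p : Prog} {s s₁ s₂ : State} (h : Frame p s s₁) (h' : Frame p s₁ s₂) :
    Frame p s s₂ :=
  ⟨fun x hx => (h'.reg x hx).trans (h.reg x hx), fun a ha => (h'.arr a ha).trans (h.arr a ha)⟩

theorem Frame.mono {p q : Prog} {s s' : State} (h : Frame p s s')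
    (hr : p.regs ⊆ q.regs) (ha : p.arrs ⊆ q.arrs) : Frame q s s' :=
  ⟨fun x hx => h.reg x fun h' => hx (hr h'), fun a hx => h.arr a fun h' => hx (ha h')⟩

/-- Thanks to this syntactic bound, loop invariants need to mention only what the body writes; the
side conditions are decidable memberships in concrete lists. -/
theorem Exec.frame {p : Prog} {s s' : State} {t : ℕ} (h : Exec p s t s') : Frame p s s' := by
  induction h with
  | skip s => exact .refl _ _
  | assign x e s =>
    exact ⟨fun y hy => by simp_all [Prog.regs], fun _ _ => rfl⟩
  | store a i e s =>
    exact ⟨fun _ _ => rfl, fun b hb => by simp_all [Prog.arrs, setArr_arr]⟩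
  | seq _ _ ih ih' =>
    exact (ih.mono (by simp [Prog.regs]) (by simp [Prog.arrs])).trans
      (ih'.mono (by simp [Prog.regs]) (by simp [Prog.arrs]))
  | cond_true _ _ ih => exact ih.mono (by simp [Prog.regs]) (by simp [Prog.arrs])
  | cond_false _ _ ih => exact ih.mono (by simp [Prog.regs]) (by simp [Prog.arrs])
  | loop_true _ _ _ ih ih' =>
    exact (ih.mono (by simp [Prog.regs]) (by simp [Prog.arrs])).trans ih'
  | loop_false _ => exact .refl _ _

theorem Runs.mono {p : Prog} {s : State} {B B' : ℕ} {Q Q' : State → Prop} (h : Runs p s B Q)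
    (hB : B ≤ B') (hQ : ∀ s', Frame p s s' → Q s' → Q' s') : Runs p s B' Q' := by
  obtain ⟨t, s', he, ht, hq⟩ := h
  exact ⟨t, s', he, ht.trans hB, hQ s' he.frame hq⟩

theorem Runs.imp {p : Prog} {s : State} {B : ℕ} {Q Q' : State → Prop} (h : Runs p s B Q)
    (hQ : ∀ s', Frame p s s' → Q s' → Q' s') : Runs p s B Q' :=
  h.mono le_rfl hQ

theorem Runs.skip {s : State} {B : ℕ} {Q : State → Prop} (h : Q s)
    (hB : 1 ≤ B := by first | decide | omega | (simp only [Expr.cost]; omega)) : Runs .skip s B Q :=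
  ⟨_, _, .skip s, hB, h⟩

theorem Runs.assign {x : ℕ} {e : Expr} {s : State} {B : ℕ} {Q : State → Prop}
    (h : Q (s.setReg x (e.eval s)))
    (hB : e.cost + 1 ≤ B := by first | decide | omega | (simp only [Expr.cost]; omega)) :
    Runs (.assign x e) s B Q :=
  ⟨_, _, .assign x e s, hB, h⟩

theorem Runs.store {a : ℕ} {i e : Expr} {s : State} {B : ℕ} {Q : State → Prop}
    (h : Q (s.setArr a (i.eval s) (e.eval s)))
    (hB : i.cost + e.cost + 1 ≤ B := by first | decide | omega | (simp only [Expr.cost]; omega)) :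
    Runs (.store a i e) s B Q :=
  ⟨_, _, .store a i e s, hB, h⟩

theorem Runs.seq {p q : Prog} {s : State} {B B₁ : ℕ} {Q : State → Prop}
    (h : Runs p s B₁ fun s₁ => Runs q s₁ (B - B₁) Q)
    (hB : B₁ ≤ B := by first | decide | omega | (simp only [Expr.cost]; omega)) :
    Runs (.seq p q) s B Q := by
  obtain ⟨t₁, s₁, h₁, ht₁, t₂, s₂, h₂, ht₂, hq⟩ := h
  exact ⟨_, _, h₁.seq h₂, by omega, hq⟩

/-- An assignment followed by another program. -/
theorem Runs.assign_seq {x : ℕ} {e : Expr} {q : Prog} {s : State} {B : ℕ} {Q : State → Prop}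
    (h : Runs q (s.setReg x (e.eval s)) (B - (e.cost + 1)) Q)
    (hB : e.cost + 1 ≤ B := by first | decide | omega | (simp only [Expr.cost]; omega)) :
    Runs (.seq (.assign x e) q) s B Q :=
  Runs.seq (Runs.assign h le_rfl) hB

/-- A store followed by another program. -/
theorem Runs.store_seq {a : ℕ} {i e : Expr} {q : Prog} {s : State} {B : ℕ} {Q : State → Prop}
    (h : Runs q (s.setArr a (i.eval s) (e.eval s)) (B - (i.cost + e.cost + 1)) Q)
    (hB : i.cost + e.cost + 1 ≤ B := by first | decide | omega | (simp only [Expr.cost]; omega)) :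
    Runs (.seq (.store a i e) q) s B Q :=
  Runs.seq (Runs.store h le_rfl) hB

theorem Runs.cond {e : Expr} {p q : Prog} {s : State} {B : ℕ} {Q : State → Prop}
    (hp : e.eval s ≠ 0 → Runs p s (B - (e.cost + 1)) Q)
    (hq : e.eval s = 0 → Runs q s (B - (e.cost + 1)) Q)
    (hB : e.cost + 1 ≤ B := by first | decide | omega | (simp only [Expr.cost]; omega)) :
    Runs (.cond e p q) s B Q := by
  by_cases he : e.eval s = 0
  · obtain ⟨t, s', h, ht, hQ⟩ := hq he
    exact ⟨_, _, .cond_false he h, by omega, hQ⟩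
  · obtain ⟨t, s', h, ht, hQ⟩ := hp he
    exact ⟨_, _, .cond_true he h, by omega, hQ⟩

/-- Loops with an invariant `I` and a variant `μ`. -/
theorem Runs.loop {e : Expr} {p : Prog} {s : State} {B N : ℕ} (I : State → Prop) (μ : State → ℕ)
    (h₀ : I s) (hN : μ s ≤ N)
    (step : ∀ s', Frame p s s' → I s' → e.eval s' ≠ 0 →
      Runs p s' B fun s'' => I s'' ∧ μ s'' < μ s') :
    Runs (.loop e p) s ((N + 1) * (e.cost + 1 + B)) fun s' => I s' ∧ e.eval s' = 0 := by
  suffices H : ∀ N s', Frame p s s' → I s' → μ s' ≤ N →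
      Runs (.loop e p) s' ((N + 1) * (e.cost + 1 + B)) fun s'' => I s'' ∧ e.eval s'' = 0 from
    H N s (.refl _ _) h₀ hN
  intro N
  induction N with
  | zero =>
    intro s' hf hI hμ
    by_cases he : e.eval s' = 0
    · exact ⟨_, _, .loop_false he, by omega, hI, he⟩
    · obtain ⟨t, s'', _, _, _, h⟩ := step s' hf hI he
      omega
  | succ N ih =>
    intro s' hf hI hμ
    by_cases he : e.eval s' = 0
    · exact ⟨_, _, .loop_false he, by nlinarith, hI, he⟩
    · obtain ⟨t, s₁, h₁, ht, hI₁, hlt⟩ := step s' hf hI he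
      obtain ⟨t', s₂, h₂, ht', hQ⟩ := ih s₁ (hf.trans h₁.frame) hI₁ (by omega)
      exact ⟨_, _, .loop_true he h₁ h₂, by nlinarith, hQ⟩

/-- `forRange x p` runs `p` with register `x` set to `0, …, n - 1`, where `n` is the content of
register 0. -/
def forRange (x : ℕ) (p : Prog) : Prog :=
  .seq (.assign x (.const 0))
    (.loop (.sub (.var 0) (.var x)) (.seq p (.assign x (.add (.var x) (.const 1)))))

/-- The invariant `I i` of `forRange` holds before the round `i`, and `I` does not depend on the
loop counter. -/
theorem Runs.forRange {x : ℕ} {p : Prog} {s : State} {B n : ℕ} (I : ℕ → State → Prop)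
    (hn : s.reg 0 = n) (hx : x ≠ 0) (h0p : 0 ∉ p.regs) (hxp : x ∉ p.regs)
    (hI : ∀ i s' c, I i s' → I i (s'.setReg x c)) (h₀ : I 0 s)
    (step : ∀ i, i < n → ∀ s', Frame (forRange x p) s s' → s'.reg 0 = n → s'.reg x = i → I i s' →
      Runs p s' B (I (i + 1))) :
    Runs (forRange x p) s (2 + (n + 1) * (B + 8)) (I n) := by
  have hfr : ∀ {s'}, Frame (.seq p (.assign x (.add (.var x) (.const 1)))) (s.setReg x 0) s' →
      Frame (VectorConn.forRange x p) s s' := fun {s'} h =>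
    ⟨fun y hy => by
      have hy' : y ≠ x ∧ y ∉ p.regs := by
        simpa [VectorConn.forRange, Prog.regs, not_or, and_comm] using hy
      rw [h.reg y (by simpa [Prog.regs, not_or, and_comm] using hy')]
      simp [hy'.1],
    fun a ha => by
      rw [h.arr a (by simpa [VectorConn.forRange, Prog.arrs] using ha)]; rfl⟩
  have := Runs.loop (e := .sub (.var 0) (.var x))
    (p := .seq p (.assign x (.add (.var x) (.const 1)))) (s := s.setReg x 0) (B := B + 4) (N := n)
    (fun s' => s'.reg 0 = n ∧ s'.reg x ≤ n ∧ I (s'.reg x) s') (fun s' => n - s'.reg x)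
    ⟨by simp [hx.symm, hn], by simp, by simpa using hI _ _ _ h₀⟩ (by simp)
    (by
      rintro s' hf ⟨h0, hxn, hi⟩ he
      have hlt : s'.reg x < n := by simp [Expr.eval, h0] at he; omega
      refine Runs.seq ((step _ hlt s' (hfr hf) h0 rfl hi).imp fun s₁ hf₁ h₁ => ?_) (by omega)
      have e0 := hf₁.reg 0 h0p
      have ex := hf₁.reg x hxp
      refine Runs.assign ⟨⟨by simp [hx.symm, e0, h0], ?_, ?_⟩, ?_⟩
      · simp [Expr.eval, ex]; omega
      · simpa [Expr.eval, ex] using hI _ _ _ h₁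
      · simp [Expr.eval, ex]; omega)
  -- The constant 8 is `3 + 1` for the loop test plus `3 + 1` for the increment.
  refine Runs.assign_seq (this.mono (by
    rw [show (Expr.sub (.var 0) (.var x)).cost + 1 + (B + 4) = B + 8 by simp only [Expr.cost]; omega]
    simp only [Expr.cost]; omega) ?_)
  rintro s' - ⟨⟨h0, hle, hi⟩, he⟩
  simp only [Expr.eval, h0] at he
  rwa [show s'.reg x = n by omega] at hi

/-! ## Violated sets -/

section Combinatorics

/-- Two paths with the same endpoint would share a vertex of `S`, hence one other than `v`; so the
endpoints are distinct. -/
theorem HasDisjointPaths.le_card {V : Type*} {G : SimpleGraph V} {v : V} {S : Finset V} {k : ℕ}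
    (hv : v ∉ S)
    (h : HasDisjointPaths G v S k) : k ≤ S.card := by
  obtain ⟨t, P, ht, hdis⟩ := h
  have := Finset.card_le_card_of_injOn (s := Finset.univ) (t := S) t (fun i _ => ht i)
    fun i _ j _ hij => by
      by_contra hne
      have := hdis i j hne (t i) (P i).1.end_mem_support (by rw [hij]; exact (P j).1.end_mem_support)
      exact hv (this ▸ ht i)
  simpa using this

variable {V : Type*} [Fintype V] [DecidableEq V]

open Classical in
/-- The neighbourhood of a set of vertices. -/
noncomputable def boundary (G : SimpleGraph V) (X : Finset V) : Finset V :=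
  Finset.univ.filter fun w => w ∉ X ∧ ∃ u ∈ X, G.Adj u w

theorem mem_boundary {G : SimpleGraph V} {X : Finset V} {w : V} :
    w ∈ boundary G X ↔ w ∉ X ∧ ∃ u ∈ X, G.Adj u w := by
  simp [boundary]

/-- `X` avoids `S` and contains a vertex whose demand exceeds the number of neighbours of `X`. -/
def Violated (G : SimpleGraph V) (φ : V → ℕ) (S X : Finset V) : Prop :=
  Disjoint X S ∧ ∃ v ∈ X, (boundary G X).card < φ v

theorem Violated.anti {G : SimpleGraph V} {φ : V → ℕ} {S T X : Finset V}
    (h : Violated G φ T X) (hST : S ⊆ T) : Violated G φ S X :=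
  ⟨h.1.mono_right hST, h.2⟩

/-- The easy half of Menger: each path starts in `X` and ends outside, so it passes through the
boundary at a vertex other than `v`, and disjoint paths use distinct such vertices. -/
theorem IsVectorConnectivitySet.not_violated {G : SimpleGraph V} {φ : V → ℕ} {S : Finset V}
    (h : IsVectorConnectivitySet G φ S) (X : Finset V) : ¬ Violated G φ S X := by
  rintro ⟨hd, v, hv, hlt⟩
  obtain ⟨t, P, ht, hdis⟩ := h v (Finset.disjoint_left.1 hd hv)
  have key : ∀ i, ∃ w ∈ boundary G X, w ∈ (P i).1.support := fun i => by
    obtain ⟨d, hd', h₁, h₂⟩ := (P i).1.exists_boundary_dart (X : Set V) (by simpa using hv)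
      (by simpa using Finset.disjoint_right.1 hd (ht i))
    exact ⟨d.snd, mem_boundary.2 ⟨by simpa using h₂, d.fst, by simpa using h₁, d.adj⟩,
      (P i).1.dart_snd_mem_support_of_mem_darts hd'⟩
  choose f hf hfs using key
  have hinj : Function.Injective f := fun i j hij => by
    by_contra hne
    have := hdis i j hne (f i) (hfs i) (hij ▸ hfs j)
    exact (mem_boundary.1 (hf i)).1 (this ▸ hv)
  have := Finset.card_le_card_of_injOn (s := Finset.univ) (t := boundary G X) f
    (fun i _ => hf i) hinj.injOn
  simp at this
  omega

/-- Uncrossing: a violated set can be restricted to the inside or to the outside of a set whose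
boundary it avoids. -/
theorem Violated.inter_or_sdiff {G : SimpleGraph V} {φ : V → ℕ} {S X Y : Finset V}
    (h : Violated G φ S Y) (hX : Disjoint Y (boundary G X)) :
    Violated G φ S (Y ∩ X) ∨ Violated G φ S (Y \ X) := by
  obtain ⟨hd, v, hv, hlt⟩ := h
  -- No edge joins `Y ∩ X` to `Y \ X`, since its outer end would lie in `Y` and in the boundary of
  -- `X`. So the boundary of either part lies in that of `Y`, and the part containing `v` stays
  -- violated.
  by_cases hvX : v ∈ X
  · refine .inl ⟨hd.mono_left Finset.inter_subset_left, v, by simp [hv, hvX],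
      (Finset.card_le_card fun w hw => ?_).trans_lt hlt⟩
    obtain ⟨hw, u, hu, huw⟩ := mem_boundary.1 hw
    simp only [Finset.mem_inter, not_and] at hw hu
    refine mem_boundary.2 ⟨fun hwY => ?_, u, hu.1, huw⟩
    exact Finset.disjoint_left.1 hX hwY (mem_boundary.2 ⟨hw hwY, u, hu.2, huw⟩)
  · refine .inr ⟨hd.mono_left Finset.sdiff_subset, v, by simp [hv, hvX],
      (Finset.card_le_card fun w hw => ?_).trans_lt hlt⟩
    obtain ⟨hw, u, hu, huw⟩ := mem_boundary.1 hw
    simp only [Finset.mem_sdiff, not_and, not_not] at hw hu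
    refine mem_boundary.2 ⟨fun hwY => ?_, u, hu.1, huw⟩
    exact Finset.disjoint_left.1 hX hu.1 (mem_boundary.2 ⟨hu.2, w, hw hwY, huw.symm⟩)

/-! ## The greedy algorithm -/

/-- The invariant of the greedy algorithm: `D` is a union of `m` disjoint sets that are hit by every
vector connectivity set of size at most `k`. -/
structure Greedy (G : SimpleGraph V) (φ : V → ℕ) (k : ℕ) (S : Finset V) (m : ℕ) (D : Finset V) :
    Prop where
  card_le : S.card ≤ max k 1 * m
  demand_le : ∀ v, v ∉ S → φ v ≤ k
  le_inter : ∀ O, IsVectorConnectivitySet G φ O → O.card ≤ k → m ≤ (O ∩ D).card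
  exists_disjoint : ∀ Y, Violated G φ S Y → ∃ Y', Y' ⊆ Y ∧ Violated G φ S Y' ∧ Disjoint Y' D

/-- The initial vertices count as singleton sets, each forced into any solution of size at most `k`.
Each costs one vertex even if `k = 0`, whence the factor `max k 1` in `card_le`. -/
theorem Greedy.init (G : SimpleGraph V) (φ : V → ℕ) (k : ℕ) (S : Finset V)
    (hS : ∀ v, v ∈ S ↔ k < φ v) : Greedy G φ k S S.card S where
  card_le := Nat.le_mul_of_pos_left _ (by simp)
  demand_le v hv := by simpa [hS] using hv
  le_inter O hO hOk := by
    refine Finset.card_le_card fun v hv => Finset.mem_inter.2 ⟨?_, hv⟩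
    by_contra hvO
    have := (hO v hvO).le_card hvO
    have := (hS v).1 hv
    omega
  exists_disjoint Y hY := ⟨Y, subset_rfl, hY, hY.1⟩

/-- Minimality is used twice: it makes `X` disjoint from the earlier sets, and it excludes the inner
alternative in the uncrossing, because `x` has been added. -/
theorem Greedy.step {G : SimpleGraph V} {φ : V → ℕ} {k m : ℕ} {S D X : Finset V}
    (h : Greedy G φ k S m D) (hX : Violated G φ S X)
    (hmin : ∀ Y, Violated G φ S Y → Y ⊆ X → Y = X) {x : V} (hx : x ∈ X) :
    Greedy G φ k (insert x (S ∪ boundary G X)) (m + 1) (D ∪ X) := by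
  have hXD : Disjoint X D := by
    obtain ⟨Y', hY', hv, hd⟩ := h.exists_disjoint X hX
    rwa [hmin Y' hv hY'] at hd
  have hsub : S ⊆ insert x (S ∪ boundary G X) :=
    Finset.subset_union_left.trans (Finset.subset_insert _ _)
  refine ⟨?_, fun v hv => h.demand_le v fun h' => hv (hsub h'), fun O hO hOk => ?_, fun Y hY => ?_⟩
  · obtain ⟨v, hv, hlt⟩ := hX.2
    have h₁ := h.demand_le v (Finset.disjoint_left.1 hX.1 hv)
    have h₂ := Finset.card_insert_le x (S ∪ boundary G X)
    have h₃ := Finset.card_union_le S (boundary G X)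
    have h₄ := h.card_le
    have : k ≤ max k 1 := le_max_left _ _
    rw [mul_add]
    omega
  · have h₁ := h.le_inter O hO hOk
    have h₂ : 0 < (O ∩ X).card := by
      rw [Finset.card_pos, Finset.nonempty_iff_ne_empty]
      intro he
      exact hO.not_violated X ⟨(Finset.disjoint_iff_inter_eq_empty.2 he).symm, hX.2⟩
    rw [Finset.inter_union_distrib_left, Finset.card_union_of_disjoint
      (hXD.symm.mono Finset.inter_subset_right Finset.inter_subset_right)]
    omega
  · obtain ⟨Z, hZY, hZ, hZD⟩ := h.exists_disjoint Y (hY.anti hsub)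
    have hZS := hY.1.mono_left hZY
    rcases hZ.inter_or_sdiff (X := X) (hZS.mono_right fun w hw => by simp [hw]) with h' | h'
    · have := hmin _ h' Finset.inter_subset_right
      exact absurd (Finset.mem_insert_self x _) (Finset.disjoint_left.1 hZS
        (Finset.mem_inter.1 (this.symm.subset hx)).1)
    · exact ⟨Z \ X, Finset.sdiff_subset.trans hZY,
        ⟨hZS.mono_left Finset.sdiff_subset, h'.2⟩, Finset.disjoint_union_right.2
          ⟨hZD.mono_left Finset.sdiff_subset, Finset.sdiff_disjoint⟩⟩

theorem Greedy.card_le_sq {G : SimpleGraph V} {φ : V → ℕ} {k m : ℕ} {S D : Finset V}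
    (h : Greedy G φ k S m D) (hm : m ≤ k) : S.card ≤ k ^ 2 := by
  have := h.card_le
  rcases Nat.eq_zero_or_pos k with rfl | hk
  · simp_all
  · rw [max_eq_left hk] at this
    nlinarith

theorem Greedy.lt_opt {G : SimpleGraph V} {φ : V → ℕ} {k m : ℕ} {S D : Finset V}
    (h : Greedy G φ k S m D) (hm : k < m) : k < opt G φ := by
  by_contra! hle
  obtain ⟨O, hO, hc⟩ := exists_card_eq_opt G φ
  have h₁ := h.le_inter O hO (by omega)
  have h₂ := Finset.card_le_card (Finset.inter_subset_left : O ∩ D ⊆ O)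
  omega

/-- A maximal set that misses a violated set is the complement of a minimal violated set. -/
theorem violated_compl_of_maximal {G : SimpleGraph V} {φ : V → ℕ} {T X : Finset V}
    (hX : Violated G φ T X) (hmax : ∀ j, j ∉ T → ∀ Y, ¬ Violated G φ (insert j T) Y) :
    Violated G φ T Tᶜ ∧ ∀ S Y, Violated G φ S Y → Y ⊆ Tᶜ → Y = Tᶜ := by
  -- A smaller `Y` would miss some `j` outside `T` and be violated for `insert j T`. The set `S` is
  -- arbitrary because it enters violation only through disjointness.
  have key : ∀ S Y, Violated G φ S Y → Y ⊆ Tᶜ → Y = Tᶜ := fun S Y hY hYT => by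
    refine hYT.antisymm fun j hj => ?_
    by_contra hjY
    refine hmax j (by simpa using hj) Y ⟨?_, hY.2⟩
    rw [Finset.disjoint_insert_right]
    exact ⟨hjY, Finset.disjoint_left.2 fun w hw => by simpa using hYT hw⟩
  have := key T X hX fun w hw => by simpa using Finset.disjoint_left.1 hX.1 hw
  exact ⟨this ▸ hX, key⟩

/-! ## Auctions -/

/-- The invariant of an auction that decides whether `v` has `d` disjoint paths to `T`. The bidders
are `d` copies of `v` and the other vertices outside `T`; a vertex bids for itself and for its
neighbours, except for `v`. The item `w` currently belongs to the bidder `own w`, the bidder `cur`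
is served next, and `need` copies of `v` still have to be served. -/
structure Auction (G : SimpleGraph V) (T : Finset V) (v : V) (d : ℕ) (own : V → Option V)
    (price : V → ℕ) (cur : V) (need : ℕ) : Prop where
  price_self : price v = Fintype.card V + 1
  own_self : own v = none
  price_le : ∀ w, price w ≤ Fintype.card V + 1
  adj : ∀ w u, own w = some u → w = u ∨ G.Adj u w
  slack : ∀ w u, own w = some u → ∀ w', w' = u ∨ G.Adj u w' → price w ≤ price w' + 1
  owned : ∀ w, w ≠ v → price w ≠ 0 → own w ≠ none
  count_self : (∑ w, if own w = some v then 1 else 0) + (if cur = v then 1 else 0) + need = d + 1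
  count : ∀ u, u ≠ v → (∑ w, if own w = some u then 1 else 0) + (if cur = u then 1 else 0) =
    if u ∈ T then 0 else 1
  need_ne_zero : cur ≠ v → need ≠ 0

/-- Every bidder other than the copies of `v` starts out owning itself for free. The item `v` is
priced out of reach, so that no path returns to `v`. -/
theorem Auction.init (G : SimpleGraph V) (T : Finset V) (v : V) (d : ℕ) :
    Auction G T v d (fun w => if w ∈ T ∨ w = v then none else some w)
      (fun w => if w = v then Fintype.card V + 1 else 0) v d where
  price_self := by simp
  own_self := by simp
  price_le w := by split_ifs <;> simp
  adj w u h := by split_ifs at h; simp_all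
  slack w u h := by split_ifs at h; simp_all
  owned w hw h := by simp_all
  count_self := by
    rw [Finset.sum_eq_zero fun w _ => by split_ifs <;> simp_all]
    simp; omega
  count u hu := by
    rw [if_neg hu.symm]
    by_cases huT : u ∈ T
    · rw [Finset.sum_eq_zero fun w _ => by split_ifs <;> simp_all]
      simp [huT]
    · rw [Finset.sum_eq_single u (fun w _ hw => by split_ifs <;> simp_all) (by simp)]
      simp [huT, hu]
  need_ne_zero h := absurd rfl h

theorem sum_update_owner (own : V → Option V) (b cur u : V) :
    (∑ w, if Function.update own b (some cur) w = some u then 1 else 0) +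
      (if own b = some u then 1 else 0) =
    (∑ w, if own w = some u then 1 else 0) + if cur = u then 1 else 0 := by
  rw [← Finset.add_sum_erase _ _ (Finset.mem_univ b),
    ← Finset.add_sum_erase _ (fun w => if own w = some u then 1 else 0) (Finset.mem_univ b),
    Finset.sum_congr rfl fun w hw => by
      rw [Function.update_of_ne (Finset.ne_of_mem_erase hw)]]
  simp
  omega

variable {G : SimpleGraph V} {φ : V → ℕ} {T : Finset V} {v : V} {d : ℕ} {own : V → Option V}
  {price : V → ℕ} {cur : V} {need : ℕ}

/-- Selling a cheapest item `b` to the current bidder; the former owner, if there is one, becomes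
the current bidder. -/
theorem Auction.sell (h : Auction G T v d own price cur need) (hneed : need ≠ 0) {b : V}
    (hb : b = cur ∨ G.Adj cur b) (hbn : price b ≤ Fintype.card V)
    (hmin : ∀ w, w = cur ∨ G.Adj cur w → price b ≤ price w) {cur' : V} {need' : ℕ}
    (hnext : own b = none ∧ cur' = v ∧ need' = need - 1 ∨ own b = some cur' ∧ need' = need) :
    Auction G T v d (Function.update own b (some cur)) (Function.update price b (price b + 1))
      cur' need' := by
  have hbv : b ≠ v := by
    rintro rfl
    have := h.price_self
    omega
  have hle : ∀ w, price w ≤ Function.update price b (price b + 1) w := fun w => by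
    rw [Function.update_apply]; split_ifs with hw <;> simp [*]
  refine ⟨?_, ?_, fun w => ?_, fun w u hw => ?_, fun w u hw w' hw' => ?_, fun w hw hp => ?_, ?_,
    fun u hu => ?_, fun hc => ?_⟩
  · rw [Function.update_of_ne hbv.symm, h.price_self]
  · rw [Function.update_of_ne hbv.symm, h.own_self]
  · rw [Function.update_apply]
    split_ifs
    · omega
    · exact h.price_le w
  · rw [Function.update_apply] at hw
    split_ifs at hw with hwb
    · obtain rfl := Option.some.inj hw
      exact hwb ▸ hb
    · exact h.adj w u hw
  -- Prices only rise, so old slack bounds persist; the item just sold was cheapest for its buyer,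
  -- so its new price is at most one above the buyer's other options.
  · refine le_trans ?_ (Nat.add_le_add_right (hle w') 1)
    rw [Function.update_apply] at hw ⊢
    split_ifs at hw ⊢ with hwb
    · obtain rfl := Option.some.inj hw
      exact Nat.add_le_add_right (hmin w' hw') 1
    · exact h.slack w u hw w' hw'
  · rw [Function.update_apply] at hp ⊢
    split_ifs at hp ⊢ with hwb
    · simp
    · exact h.owned w hw hp
  · have h₁ := sum_update_owner own b cur v
    have h₂ := h.count_self
    rcases hnext with ⟨ho, rfl, rfl⟩ | ⟨ho, rfl⟩
    · simp only [ho, reduceCtorEq, if_false, if_true, add_zero] at h₁ ⊢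
      omega
    · simp only [ho, Option.some.injEq] at h₁
      omega
  · have h₁ := sum_update_owner own b cur u
    have h₂ := h.count u hu
    rcases hnext with ⟨ho, rfl, rfl⟩ | ⟨ho, rfl⟩
    · simp only [ho, reduceCtorEq, hu.symm, if_false, add_zero] at h₁ ⊢
      omega
    · simp only [ho, Option.some.injEq] at h₁
      omega
  · rcases hnext with ⟨ho, rfl, rfl⟩ | ⟨ho, rfl⟩
    · exact absurd rfl hc
    · exact hneed

/-- If all items of the current bidder are too expensive, then some set is violated. -/
theorem Auction.exists_violated (h : Auction G T v (φ v) own price cur need) (hneed : need ≠ 0)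
    (hcur : ∀ w, w = cur ∨ G.Adj cur w → Fintype.card V < price w) (hv : v ∉ T) :
    ∃ X, Violated G φ T X := by
  -- Pigeonhole: the vertices have at most `card V` distinct prices, so one of `card V + 1` levels
  -- is skipped.
  obtain ⟨l, hl, hlp⟩ : ∃ l ∈ Finset.range (Fintype.card V + 1), l ∉ Finset.univ.image price := by
    by_contra! hcon
    have := (Finset.card_le_card hcon).trans Finset.card_image_le
    simp at this
  simp only [Finset.mem_range, Finset.mem_image, Finset.mem_univ, true_and, not_exists] at hl hlp
  set W : Finset V := Finset.univ.filter fun w => w ≠ v ∧ l < price w with hW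
  set X : Finset V := Finset.univ.filter fun u => cur = u ∨ ∃ w ∈ W, own w = some u with hXdef
  have hmemX : ∀ {u}, u ∈ X ↔ cur = u ∨ ∃ w ∈ W, own w = some u := by simp [hXdef]
  -- An owner of an item priced above `l` has, by slack, only options priced at least `l`, hence
  -- above `l` because of the gap.
  have hclosed : ∀ u ∈ X, ∀ w, w = u ∨ G.Adj u w → w ≠ v → w ∈ W := by
    intro u hu w hw hwv
    refine Finset.mem_filter.2 ⟨Finset.mem_univ _, hwv, ?_⟩
    rcases hmemX.1 hu with rfl | ⟨w', hw', ho⟩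
    · have := hcur w hw; omega
    · have h₁ := h.slack w' u ho w hw
      have h₂ := (Finset.mem_filter.1 hw').2.2
      have h₃ := hlp w
      omega
  have hXT : Disjoint X T := by
    refine Finset.disjoint_left.2 fun u hu huT => ?_
    have huv : u ≠ v := by rintro rfl; exact hv huT
    have := h.count u huv
    rw [if_pos huT] at this
    rcases hmemX.1 hu with rfl | ⟨w, hw, ho⟩
    · simp at this
    · have : (∑ w, if own w = some u then 1 else 0) = 0 := by omega
      rw [Finset.sum_eq_zero_iff] at this
      simpa [ho] using this w (Finset.mem_univ _)
  -- All items of `W` have positive price, so they are owned, by bidders in `X`; the extra one is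
  -- the bidder being served, who is also in `X`.
  have hcount : W.card + 1 ≤ ∑ u ∈ X, ((∑ w, if own w = some u then 1 else 0) +
      if cur = u then 1 else 0) := by
    rw [Finset.sum_add_distrib, Finset.sum_ite_eq, if_pos (hmemX.2 (.inl rfl)), Finset.sum_comm,
      Finset.card_eq_sum_ones]
    refine Nat.add_le_add_right ?_ 1
    refine le_trans (Finset.sum_le_sum fun w hw => ?_)
      (Finset.sum_le_sum_of_subset (Finset.subset_univ W))
    obtain ⟨-, hwv, hlt⟩ := Finset.mem_filter.1 hw
    obtain ⟨u, hu⟩ := Option.ne_none_iff_exists'.1 (h.owned w hwv (by omega))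
    have huX : u ∈ X := hmemX.2 (.inr ⟨w, hw, hu⟩)
    exact le_trans (by simp [hu]) (Finset.single_le_sum
      (f := fun u => if own w = some u then 1 else 0) (fun _ _ => Nat.zero_le _) huX)
  have hsum : ∀ Y : Finset V, Y ⊆ X → v ∉ Y → ∑ u ∈ Y, ((∑ w, if own w = some u then 1 else 0) +
      if cur = u then 1 else 0) = Y.card := fun Y hY hvY => by
    rw [Finset.card_eq_sum_ones]
    refine Finset.sum_congr rfl fun u hu => ?_
    rw [h.count u (by rintro rfl; exact hvY hu), if_neg (Finset.disjoint_left.1 hXT (hY hu))]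
  -- Without `v`, the set `X` has one bidder per vertex, fewer than needed since `X ⊆ W`.
  have hvX : v ∈ X := by
    by_contra hvX
    rw [hsum X subset_rfl hvX] at hcount
    have := Finset.card_le_card (s := X) (t := W) fun u hu =>
      hclosed u hu u (.inl rfl) (by rintro rfl; exact hvX hu)
    omega
  refine ⟨X, hXT, v, hvX, ?_⟩
  rw [← Finset.add_sum_erase _ _ hvX, hsum _ (Finset.erase_subset _ _) (by simp)] at hcount
  have h₁ := h.count_self
  -- As `need` is positive, at most `φ v` copies of `v` are counted; cancelling the vertices of
  -- `X.erase v` on both sides leaves the boundary smaller than `φ v`.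
  have h₂ : (X.erase v ∪ boundary G X).card ≤ W.card := Finset.card_le_card fun w hw => by
    rcases Finset.mem_union.1 hw with hw | hw
    · exact hclosed w (Finset.mem_of_mem_erase hw) w (.inl rfl) (Finset.ne_of_mem_erase hw)
    · obtain ⟨hwX, u, hu, huw⟩ := mem_boundary.1 hw
      exact hclosed u hu w (.inr huw) (by rintro rfl; exact hwX hvX)
  rw [Finset.card_union_of_disjoint (Finset.disjoint_left.2 fun w hw hw' =>
    (mem_boundary.1 hw').1 (Finset.mem_of_mem_erase hw))] at h₂
  omega

/-- If all bidders are served, then following the items yields disjoint paths. -/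
theorem Auction.hasDisjointPaths (h : Auction G T v d own price cur 0) :
    HasDisjointPaths G v T d := by
  have hcur : cur = v := by
    by_contra hc
    exact h.need_ne_zero hc rfl
  subst hcur
  have hne : ∀ {w u}, own w = some u → w ≠ cur := by
    rintro w u hw rfl
    simp [h.own_self] at hw
  -- The path continues from `u` to the item that `u` owns; the value at other vertices is
  -- irrelevant.
  have hex : ∀ u, ∃ w, u ∉ T → u ≠ cur → own w = some u := fun u => by
    by_cases hu : u ∉ T ∧ u ≠ cur
    · have := h.count u hu.2
      rw [if_neg hu.1, if_neg hu.2.symm] at this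
      obtain ⟨w, -, hw⟩ := Finset.exists_ne_zero_of_sum_ne_zero
        (show (∑ w, if own w = some u then 1 else 0) ≠ 0 by omega)
      exact ⟨w, fun _ _ => by by_contra h'; simp [h'] at hw⟩
    · exact ⟨u, fun h₁ h₂ => absurd ⟨h₁, h₂⟩ hu⟩
  choose f hf using hex
  have hcard : (Finset.univ.filter fun w => own w = some cur).card = d := by
    have := h.count_self
    rw [Finset.card_filter]
    simp at this ⊢
    omega
  let a : Fin d → V := fun i => ((Finset.equivFinOfCardEq hcard).symm i).1
  have ha : ∀ i, own (a i) = some cur := fun i =>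
    (Finset.mem_filter.1 ((Finset.equivFinOfCardEq hcard).symm i).2).2
  have hainj : Function.Injective a :=
    Subtype.val_injective.comp (Finset.equivFinOfCardEq hcard).symm.injective
  -- the iterates stay away from `cur` until they reach `T`
  have hiter : ∀ i k, (∀ j < k, f^[j] (a i) ∉ T) → f^[k] (a i) ≠ cur := by
    intro i k
    induction k with
    | zero => exact fun _ => hne (ha i)
    | succ k ih =>
      intro hk
      rw [Function.iterate_succ_apply']
      exact hne (hf _ (hk k (by omega)) (ih fun j hj => hk j (by omega)))
  have hown : ∀ i k, (∀ j < k + 1, f^[j] (a i) ∉ T) →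
      own (f^[k + 1] (a i)) = some (f^[k] (a i)) := fun i k hk => by
    rw [Function.iterate_succ_apply']
    exact hf _ (hk k (by omega)) (hiter i k fun j hj => hk j (by omega))
  -- Trace back: the owner of an item is its predecessor, and only starting items are owned by
  -- `cur`. This yields disjointness, and also termination, as an orbit avoiding `T` would be
  -- infinite.
  have huniq : ∀ i i' k k', (∀ j < k, f^[j] (a i) ∉ T) → (∀ j < k', f^[j] (a i') ∉ T) →
      f^[k] (a i) = f^[k'] (a i') → i = i' ∧ k = k' := by
    intro i i' k
    induction k with
    | zero =>
      rintro (_ | k') hk hk' he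
      · exact ⟨hainj he, rfl⟩
      · have h₁ := hown i' k' hk'
        rw [← he, Function.iterate_zero_apply, ha i, Option.some.injEq] at h₁
        exact absurd h₁.symm (hiter i' k' fun j hj => hk' j (by omega))
    | succ k ih =>
      rintro (_ | k') hk hk' he
      · have h₁ := hown i k hk
        rw [he, Function.iterate_zero_apply, ha i', Option.some.injEq] at h₁
        exact absurd h₁.symm (hiter i k fun j hj => hk j (by omega))
      · have h₁ := hown i k hk
        rw [he, hown i' k' hk', Option.some.injEq] at h₁
        obtain ⟨h₂, h₃⟩ := ih k' (fun j hj => hk j (by omega)) (fun j hj => hk' j (by omega)) h₁.symm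
        exact ⟨h₂, by omega⟩
  have hreach : ∀ i, ∃ k, f^[k] (a i) ∈ T := fun i => by
    by_contra! hcon
    exact not_injective_infinite_finite (fun k => f^[k] (a i)) fun k k' he =>
      (huniq i i k k' (fun j _ => hcon j) (fun j _ => hcon j) he).2
  have hwalk : ∀ i k, (∀ j < k, f^[j] (a i) ∉ T) → ∃ p : G.Walk cur (f^[k] (a i)),
      ∀ x ∈ p.support, x = cur ∨ ∃ j ≤ k, x = f^[j] (a i) := by
    intro i k
    induction k with
    | zero =>
      intro _
      have hadj : G.Adj cur (a i) := (h.adj _ _ (ha i)).resolve_left (hne (ha i))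
      exact ⟨hadj.toWalk, fun x hx => by simpa using hx⟩
    | succ k ih =>
      intro hk
      obtain ⟨p, hp⟩ := ih fun j hj => hk j (by omega)
      -- A vertex that owns itself makes the walk stay in place.
      rcases h.adj _ _ (hown i k hk) with he | hadj
      · rw [he]
        refine ⟨p, fun x hx => (hp x hx).imp_right ?_⟩
        rintro ⟨j, hj, rfl⟩
        exact ⟨j, by omega, rfl⟩
      · refine ⟨p.concat hadj, fun x hx => ?_⟩
        rw [SimpleGraph.Walk.support_concat, List.mem_append, List.mem_singleton] at hx
        rcases hx with hx | rfl
        · refine (hp x hx).imp_right ?_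
          rintro ⟨j, hj, rfl⟩
          exact ⟨j, by omega, rfl⟩
        · exact .inr ⟨k + 1, le_rfl, rfl⟩
  classical
  choose p hp using fun i => hwalk i (Nat.find (hreach i)) fun j hj => Nat.find_min (hreach i) hj
  refine ⟨fun i => f^[Nat.find (hreach i)] (a i), fun i => (p i).toPath,
    fun i => Nat.find_spec (hreach i), fun i j hij w hw hw' => ?_⟩
  rcases hp i w ((p i).support_toPath_subset_support hw) with h₁ | ⟨k, hk, h₁⟩
  · exact h₁
  rcases hp j w ((p j).support_toPath_subset_support hw') with h₂ | ⟨k', hk', h₂⟩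
  · exact h₂
  exact absurd (huniq i j k k' (fun l hl => Nat.find_min (hreach i) (by omega))
    (fun l hl => Nat.find_min (hreach j) (by omega)) (h₁.symm.trans h₂)).1 hij

end Combinatorics

/-! ## The program

Registers: 0 the number of vertices, 1 the parameter `k` of the greedy algorithm, 2 whether to
continue with the next `k`, 3 the number `m` of sets found so far, 4 the result of the check.
Arrays: 0 the adjacency matrix, 1 the demands, 2 the set `S`, 3 the set `T`, 4 the owners and 5 the
prices in the auction, 6 the offsets of the rows of the adjacency matrix. -/

section Program

/-- Find the cheapest item for the bidder in register 8. -/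
def scan : Prog :=
  .seq (.assign 10 (.var 8)) <| .seq (.assign 9 (.load 5 (.var 8))) <|
  .seq (.assign 11 (.load 6 (.var 8))) <|
  forRange 12 <| .cond (.load 0 (.add (.var 11) (.var 12)))
    (.cond (.sub (.var 9) (.load 5 (.var 12)))
      (.seq (.assign 9 (.load 5 (.var 12))) (.assign 10 (.var 12))) .skip)
    .skip

/-- Sell an item to the bidder in register 8, or stop if all items are too expensive. -/
def auctionStep : Prog :=
  .seq scan <| .cond (.sub (.var 9) (.var 0))
    (.seq (.assign 4 (.const 0)) (.assign 7 (.const 0)))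
    (.seq (.assign 13 (.load 4 (.var 10))) <|
      .seq (.store 4 (.var 10) (.add (.var 8) (.const 1))) <|
      .seq (.store 5 (.var 10) (.add (.var 9) (.const 1))) <|
      .cond (.var 13) (.assign 8 (.sub (.var 13) (.const 1)))
        (.seq (.assign 7 (.sub (.var 7) (.const 1))) (.assign 8 (.var 5))))

/-- Set up the auction for the vertex in register 5. -/
def auctionInit : Prog :=
  .seq (forRange 6 <| .seq (.store 5 (.var 6) (.const 0)) <|
    .cond (.load 3 (.var 6)) (.store 4 (.var 6) (.const 0))
      (.store 4 (.var 6) (.add (.var 6) (.const 1)))) <|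
  .seq (.store 4 (.var 5) (.const 0)) <|
  .seq (.store 5 (.var 5) (.add (.var 0) (.const 1))) <|
  .seq (.assign 7 (.load 1 (.var 5))) (.assign 8 (.var 5))

/-- Decide whether the demand of the vertex in register 5 is satisfied. -/
def auction : Prog :=
  .seq auctionInit (.loop (.var 7) auctionStep)

/-- Decide whether `T` is a vector connectivity set. -/
def check : Prog :=
  .seq (.assign 4 (.const 1)) <|
  forRange 5 <| .cond (.load 3 (.var 5)) .skip (.cond (.var 4) auction .skip)

/-- Extend `T` to a maximal set that is not a vector connectivity set. -/
def maximalize : Prog :=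
  forRange 14 <| .seq (.store 3 (.var 14) (.const 1)) <| .seq check <|
    .cond (.var 4) (.store 3 (.var 14) (.const 0)) .skip

/-- Add the neighbours of the vertex in register 15 that lie in `T` to `S`. -/
def addNeighbors : Prog :=
  .seq (.assign 18 (.load 6 (.var 15))) <|
  forRange 17 <| .cond (.load 0 (.add (.var 18) (.var 17)))
    (.store 2 (.var 17) (.add (.load 2 (.var 17)) (.load 3 (.var 17)))) .skip

/-- Add the boundary of the complement of `T` and a vertex outside `T` to `S`. -/
def grow : Prog :=
  .seq (forRange 16 <| .cond (.load 3 (.var 16)) .skip (.seq (.assign 15 (.var 16)) addNeighbors))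
    (.store 2 (.var 15) (.const 1))

/-- One round of the greedy algorithm. -/
def greedyStep : Prog :=
  .seq (forRange 22 <| .store 3 (.var 22) (.load 2 (.var 22))) <|
  .seq check <| .cond (.var 4) .skip <|
    .seq maximalize <| .seq grow <| .seq (.assign 3 (.add (.var 3) (.const 1)))
      (.assign 4 (.const 0))

/-- Start with the vertices of demand more than `k`. -/
def greedyInit : Prog :=
  .seq (.assign 3 (.const 0)) <| .seq (.assign 4 (.const 0)) <|
  forRange 21 <| .cond (.sub (.load 1 (.var 21)) (.var 1))
    (.seq (.store 2 (.var 21) (.const 1)) (.assign 3 (.add (.var 3) (.const 1))))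
    (.store 2 (.var 21) (.const 0))

/-- The greedy algorithm for the parameter `k`. -/
def greedy : Prog :=
  .seq greedyInit (.loop (.sub (.const 1) (.var 4)) greedyStep)

/-- Compute the offsets of the rows of the adjacency matrix. -/
def rows : Prog :=
  .seq (.assign 20 (.const 0)) <|
  forRange 19 <| .seq (.store 6 (.var 19) (.var 20)) (.assign 20 (.add (.var 20) (.var 0)))

/-- Run the greedy algorithm for `k = 0, 1, …` until at most `k` sets are found. -/
def approximation : Prog :=
  .seq rows <| .seq (.assign 1 (.const 0)) <| .seq (.assign 2 (.const 1)) <|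
  .loop (.var 2) <| .seq greedy <|
    .cond (.sub (.var 3) (.var 1)) (.assign 1 (.add (.var 1) (.const 1))) (.assign 2 (.const 0))

/-! ### Running times -/

variable {R : Type*} [CommSemiring R]

/-- Bound on the running time of `scan`. -/
def scanTime (n : R) : R := 20 + (n + 1) * 40
/-- Bound on the running time of `auctionStep`. -/
def auctionStepTime (n : R) : R := 60 + scanTime n
/-- Bound on the running time of `auctionInit`. -/
def auctionInitTime (n : R) : R := 40 + (n + 1) * 40
/-- Bound on the running time of `auction`. -/
def auctionTime (n : R) : R := auctionInitTime n + (n * (n + 1) + 2) * (2 + auctionStepTime n)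
/-- Bound on the running time of `check`. -/
def checkTime (n : R) : R := 10 + (n + 1) * (20 + auctionTime n)
/-- Bound on the running time of `maximalize`. -/
def maximalizeTime (n : R) : R := 10 + (n + 1) * (40 + checkTime n)
/-- Bound on the running time of `addNeighbors`. -/
def addNeighborsTime (n : R) : R := 20 + (n + 1) * 40
/-- Bound on the running time of `grow`. -/
def growTime (n : R) : R := 20 + (n + 1) * (20 + addNeighborsTime n)
/-- Bound on the running time of `greedyStep`. -/
def greedyStepTime (n : R) : R :=
  60 + (n + 1) * 40 + checkTime n + maximalizeTime n + growTime n
/-- Bound on the running time of `greedyInit`. -/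
def greedyInitTime (n : R) : R := 20 + (n + 1) * 40
/-- Bound on the running time of `greedy`. -/
def greedyTime (n : R) : R := greedyInitTime n + (n + 2) * (4 + greedyStepTime n)
/-- Bound on the running time of `approximation`. -/
def approximationTime (n : R) : R := 20 + (n + 1) * 40 + (n + 2) * (2 + (20 + greedyTime n))

end Program

/-! ## Correctness of the program -/

/-- The set of vertices whose cell in array `a` is nonzero. -/
def cells (n a : ℕ) (s : State) : Finset (Fin n) :=
  Finset.univ.filter fun v => s.arr a v ≠ 0

theorem mem_cells {n a : ℕ} {s : State} {v : Fin n} : v ∈ cells n a s ↔ s.arr a v ≠ 0 := by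
  simp [cells]

theorem cells_congr {n a b : ℕ} {s s' : State} (h : s.arr a = s'.arr b) :
    cells n a s = cells n b s' := by
  simp [cells, h]

/-- The state contains the input and the offsets of the rows of the adjacency matrix. -/
structure Input {n : ℕ} (G : SimpleGraph (Fin n)) (φ : Fin n → ℕ) (s : State) : Prop where
  size : s.reg 0 = n
  adj : ∀ u v : Fin n, s.arr 0 (u * n + v) ≠ 0 ↔ G.Adj u v
  demand : ∀ v : Fin n, s.arr 1 v = φ v
  row : ∀ u : Fin n, s.arr 6 u = u * n

/-- The owner of an item as a number. -/
def code {n : ℕ} : Option (Fin n) → ℕ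
  | none => 0
  | some u => u + 1

section Correctness

variable {n : ℕ} {G : SimpleGraph (Fin n)} {φ : Fin n → ℕ} {s : State}

theorem Input.frame {p : Prog} {s' : State} (h : Input G φ s) (hf : Frame p s s')
    (hr : 0 ∉ p.regs) (ha : ∀ a ∈ [0, 1, 6], a ∉ p.arrs) : Input G φ s' := by
  have h0 := hf.arr 0 (ha 0 (by simp))
  have h1 := hf.arr 1 (ha 1 (by simp))
  have h6 := hf.arr 6 (ha 6 (by simp))
  exact ⟨by rw [hf.reg 0 hr, h.size], by rw [h0]; exact h.adj, by rw [h1]; exact h.demand,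
    by rw [h6]; exact h.row⟩

theorem Input.setReg (h : Input G φ s) {x : ℕ} (hx : x ≠ 0) (c : ℕ) : Input G φ (s.setReg x c) :=
  ⟨by simp [hx.symm, h.size], h.adj, h.demand, h.row⟩

theorem Input.setArr (h : Input G φ s) {a : ℕ} (ha : a ∉ [0, 1, 6]) (i c : ℕ) :
    Input G φ (s.setArr a i c) := by
  simp only [List.mem_cons, List.not_mem_nil, or_false, not_or] at ha
  exact ⟨h.size, by simpa [setArr_arr, Ne.symm ha.1] using h.adj,
    by simpa [setArr_arr, Ne.symm ha.2.1] using h.demand,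
    by simpa [setArr_arr, Ne.symm ha.2.2] using h.row⟩

/-! ### The auction on the machine -/

theorem runs_scan (hin : Input G φ s) {cur : Fin n} (hcur : s.reg 8 = cur) :
    Runs scan s (scanTime n) fun s' => ∃ b : Fin n, s'.reg 10 = b ∧ s'.reg 9 = s.arr 5 b ∧
      (b = cur ∨ G.Adj cur b) ∧ ∀ w, w = cur ∨ G.Adj cur w → s.arr 5 b ≤ s.arr 5 w := by
  unfold scanTime
  refine Runs.assign_seq <| Runs.assign_seq <| Runs.assign_seq <| Runs.mono
    (Runs.forRange (n := n) (B := 20) (fun i s' => ∃ b : Fin n, s'.reg 10 = b ∧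
      s'.reg 9 = s.arr 5 b ∧ (b = cur ∨ G.Adj cur b) ∧ s.arr 5 b ≤ s.arr 5 cur ∧
      ∀ w : Fin n, w < i → G.Adj cur w → s.arr 5 b ≤ s.arr 5 w)
      (by simp [hin.size]) (by decide) (by decide) (by decide)
      (fun i s' c h => by simpa using h) ⟨cur, by simp [Expr.eval, hcur]⟩ ?_)
    (by simp only [Expr.cost]; omega) ?_
  · rintro i hi s' hf - hx ⟨b, h10, h9, hb, hbc, hmin⟩
    have h0 := hf.arr 0 (by decide)
    have h5 := hf.arr 5 (by decide)
    have h11 := hf.reg 11 (by decide)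
    simp only [setReg_reg, setReg_arr, Expr.eval, hcur] at h0 h5 h11
    norm_num only [if_true, if_false] at h11
    rw [hin.row] at h11
    have hadj := hin.adj cur ⟨i, hi⟩
    refine Runs.cond (fun he => Runs.cond (fun he' => ?_) fun he' => ?_) fun he => ?_
    · simp only [Expr.eval, h11, h0, hx, h9, h5] at he he'
      refine Runs.assign_seq <| Runs.assign ⟨⟨i, hi⟩, ?_, ?_, .inr (hadj.1 he), ?_, ?_⟩
      · simp [Expr.eval, hx]
      · simp [Expr.eval, hx, h5]
      · dsimp only; omega
      · intro w hw hcw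
        rcases Nat.lt_succ_iff_lt_or_eq.1 hw with hw | hw
        · have := hmin w hw hcw
          dsimp only; omega
        · simp [← hw]
    · simp only [Expr.eval, h11, h0, hx, h9, h5] at he he'
      refine Runs.skip ⟨b, h10, h9, hb, hbc, fun w hw hcw => ?_⟩
      rcases Nat.lt_succ_iff_lt_or_eq.1 hw with hw | hw
      · exact hmin w hw hcw
      · rw [hw]; omega
    · simp only [Expr.eval, h11, h0, hx] at he
      refine Runs.skip ⟨b, h10, h9, hb, hbc, fun w hw hcw => ?_⟩
      rcases Nat.lt_succ_iff_lt_or_eq.1 hw with hw | hw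
      · exact hmin w hw hcw
      · obtain rfl : w = ⟨i, hi⟩ := Fin.ext hw
        exact absurd he (hadj.2 hcw)
  · rintro s' - ⟨b, h10, h9, hb, hbc, hmin⟩
    refine ⟨b, h10, h9, hb, fun w hw => ?_⟩
    rcases hw with rfl | hw
    · exact hbc
    · exact hmin w w.2 hw

/-- The registers 7 and 8 and the arrays 4 and 5 describe an auction. -/
def AuctionState (G : SimpleGraph (Fin n)) (φ : Fin n → ℕ) (T : Finset (Fin n)) (v : Fin n)
    (s : State) : Prop :=
  ∃ (own : Fin n → Option (Fin n)) (cur : Fin n), (∀ w : Fin n, s.arr 4 w = code (own w)) ∧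
    s.reg 8 = cur ∧ Auction G T v (φ v) own (fun w => s.arr 5 w) cur (s.reg 7)

theorem update_fin {α : Type*} (f : ℕ → α) (b : Fin n) (c : α) (w : Fin n) :
    Function.update f b c w = Function.update (fun w : Fin n => f w) b c w := by
  simp [Function.update_apply, Fin.ext_iff]

/-- A sale raises one price and so lowers the total distance of the prices to `n + 1`. A failing
step leaves prices alone; there the variant of the auction loop drops through the flag in register
4. -/
theorem runs_auctionStep (hin : Input G φ s) {T : Finset (Fin n)} {v : Fin n} (hv : s.reg 5 = v)
    (hvT : v ∉ T) (hneed : s.reg 7 ≠ 0) (h : AuctionState G φ T v s) :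
    Runs auctionStep s (auctionStepTime n) fun s' =>
      (s'.reg 4 = s.reg 4 ∧ AuctionState G φ T v s' ∧
        ∑ w : Fin n, (n + 1 - s'.arr 5 w) < ∑ w : Fin n, (n + 1 - s.arr 5 w)) ∨
      (s'.reg 4 = 0 ∧ s'.reg 7 = 0 ∧ (∃ X, Violated G φ T X) ∧ s'.arr 5 = s.arr 5) := by
  obtain ⟨own, cur, hown, hcur, ha⟩ := h
  unfold auctionStepTime
  refine Runs.seq ((runs_scan hin hcur).imp ?_)
  rintro s₁ hf ⟨b, h10, h9, hb, hmin⟩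
  have r0 := (hf.reg 0 (by decide)).trans hin.size
  have r4 := hf.reg 4 (by decide)
  have r5 := (hf.reg 5 (by decide)).trans hv
  have r7 := hf.reg 7 (by decide)
  have r8 := (hf.reg 8 (by decide)).trans hcur
  have a4 := hf.arr 4 (by decide)
  have a5 := hf.arr 5 (by decide)
  have hle := ha.price_le b
  simp only [Fintype.card_fin] at hle
  refine Runs.cond (fun he => ?_) fun he => ?_
  · simp only [Expr.eval, h9, r0] at he
    refine Runs.assign_seq <| Runs.assign <| .inr ⟨by simp [Expr.eval], by simp [Expr.eval],
      ha.exists_violated hneed (fun w hw => ?_) hvT, by simp [a5]⟩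
    have := hmin w hw
    simp only [Fintype.card_fin]
    omega
  · simp only [Expr.eval, h9, r0] at he
    refine Runs.assign_seq <| Runs.store_seq <| Runs.store_seq ?_
    simp only [Expr.eval, setReg_reg, setArr_reg, h10, r8, h9, a4, hown]
    norm_num only [if_true, if_false]
    set s₂ := ((s₁.setReg 13 (code (own b))).setArr 4 b (cur + 1)).setArr 5 b (s.arr 5 b + 1)
      with hs₂
    have b4 : ∀ w : Fin n, s₂.arr 4 w = code (Function.update own b (some cur) w) := fun w => by
      simp only [hs₂, setArr_arr, setReg_arr, a4]
      norm_num only [if_true, if_false]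
      simp only [Function.update_apply, Fin.ext_iff]
      split_ifs
      · rfl
      · exact hown w
    have b5 : (fun w : Fin n => s₂.arr 5 w) =
        Function.update (fun w : Fin n => s.arr 5 w) b (s.arr 5 b + 1) := funext fun w => by
      simp only [hs₂, setArr_arr, setReg_arr, a5]
      norm_num only [if_true, if_false]
      exact update_fin _ _ _ _
    have hsum : ∑ w : Fin n, (n + 1 - s₂.arr 5 w) < ∑ w : Fin n, (n + 1 - s.arr 5 w) := by
      refine Finset.sum_lt_sum (fun w _ => ?_) ⟨b, Finset.mem_univ _, ?_⟩
      · rw [congrFun b5 w, Function.update_apply]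
        split_ifs with hw
        · subst hw; omega
        · exact le_rfl
      · rw [congrFun b5 b, Function.update_self]
        omega
    have hbn : s.arr 5 b ≤ Fintype.card (Fin n) := by simp only [Fintype.card_fin]; omega
    have e4 : s₂.reg 4 = s.reg 4 := by simp [hs₂, r4]
    have e7 : s₂.reg 7 = s.reg 7 := by simp [hs₂, r7]
    have e5 : s₂.reg 5 = v := by simp [hs₂, r5]
    have e13 : s₂.reg 13 = code (own b) := by simp [hs₂]
    refine Runs.cond (fun he' => ?_) fun he' => ?_
    · simp only [Expr.eval, e13] at he'
      obtain ⟨u, hu⟩ : ∃ u, own b = some u := by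
        cases hob : own b with
        | none => simp [hob, code] at he'
        | some u => exact ⟨u, rfl⟩
      refine Runs.assign <| .inl ⟨by simp [e4], ⟨_, u, b4, ?_, ?_⟩, hsum⟩
      · simp [Expr.eval, e13, hu, code]
      · simpa [b5, e7] using ha.sell hneed hb hbn hmin (.inr ⟨hu, rfl⟩)
    · simp only [Expr.eval, e13] at he'
      have hu : own b = none := by
        cases hob : own b with
        | none => rfl
        | some u => simp [hob, code] at he'
      refine Runs.assign_seq <| Runs.assign <| .inl ⟨by simp [e4], ⟨_, v, b4, ?_, ?_⟩, hsum⟩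
      · simp [Expr.eval, e5]
      · simpa [b5, e7, Expr.eval] using ha.sell hneed hb hbn hmin (.inl ⟨hu, rfl, rfl⟩)

theorem runs_auctionInit (hin : Input G φ s) {v : Fin n} (hv : s.reg 5 = v) :
    Runs auctionInit s (auctionInitTime n) (AuctionState G φ (cells n 3 s) v) := by
  unfold auctionInitTime
  refine Runs.seq (Runs.imp (Runs.forRange (n := n) (B := 20) (fun i s' => ∀ w : Fin n, w < i →
      s'.arr 5 w = 0 ∧ s'.arr 4 w = if w ∈ cells n 3 s then (0 : ℕ) else w + 1)
      hin.size (by decide) (by decide) (by decide) (fun i s' c h => h)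
      (fun w hw => absurd hw (Nat.not_lt_zero _)) ?_) ?_)
  · intro i hi s' hf _ hx h
    have a3 := hf.arr 3 (by decide)
    refine Runs.store_seq <| Runs.cond (fun he => ?_) fun he => ?_
    · simp only [Expr.eval, setArr_arr, setArr_reg, hx, a3] at he
      norm_num only [if_false] at he
      refine Runs.store fun w hw => ?_
      simp only [Expr.eval, setArr_arr, setArr_reg, hx]
      norm_num only [if_false, if_true]
      rcases Nat.lt_succ_iff_lt_or_eq.1 hw with hw | hw
      · simpa [Function.update_apply, hw.ne] using h w hw
      · simp [hw, mem_cells, he]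
    · simp only [Expr.eval, setArr_arr, setArr_reg, hx, a3] at he
      norm_num only [if_false] at he
      refine Runs.store fun w hw => ?_
      simp only [Expr.eval, setArr_arr, setArr_reg, hx]
      norm_num only [if_false, if_true]
      rcases Nat.lt_succ_iff_lt_or_eq.1 hw with hw | hw
      · simpa [Function.update_apply, hw.ne] using h w hw
      · simp [hw, mem_cells, he]
  · intro s₁ hf h
    have r0 := (hf.reg 0 (by decide)).trans hin.size
    have r5 := (hf.reg 5 (by decide)).trans hv
    have a1 := hf.arr 1 (by decide)
    refine Runs.store_seq <| Runs.store_seq <| Runs.assign_seq <| Runs.assign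
      ⟨fun w => if w ∈ cells n 3 s ∨ w = v then none else some w, v, fun w => ?_, ?_, ?_⟩
    · simp only [Expr.eval, setArr_arr, setReg_arr, setArr_reg, r5]
      norm_num only [if_false, if_true]
      by_cases hw : w = v
      · simp [hw, code]
      · rw [update_fin, Function.update_of_ne hw, (h w w.2).2]
        by_cases hw' : w ∈ cells n 3 s <;> simp [hw, hw', code]
    · simp [Expr.eval, r5]
    · have e7 : φ v = s₁.arr 1 v := by rw [a1, hin.demand]
      have := Auction.init G (cells n 3 s) v (φ v)
      simp only [Expr.eval, setArr_arr, setReg_arr, setArr_reg, setReg_reg, r5, r0]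
      norm_num only [if_false, if_true]
      rw [← e7]
      convert this using 2 with w
      rw [update_fin, Function.update_apply]
      simp [(h _ _).1]

theorem runs_auction (hin : Input G φ s) {v : Fin n} (hv : s.reg 5 = v) (h4 : s.reg 4 = 1)
    (hvT : v ∉ cells n 3 s) :
    Runs auction s (auctionTime n) fun s' =>
      (s'.reg 4 = 1 ∧ HasDisjointPaths G v (cells n 3 s) (φ v)) ∨
      (s'.reg 4 = 0 ∧ ∃ X, Violated G φ (cells n 3 s) X) := by
  unfold auctionTime
  refine Runs.seq ((runs_auctionInit hin hv).imp fun s₁ hf h => ?_)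
  have hin₁ := hin.frame hf (by decide) (by decide)
  have r5 := (hf.reg 5 (by decide)).trans hv
  have r4 := (hf.reg 4 (by decide)).trans h4
  -- Each of `n` prices can rise at most `n + 1` times; the extra one is the flag.
  refine Runs.mono (Runs.loop (B := auctionStepTime n) (N := n * (n + 1) + 1)
    (fun s' => (s'.reg 4 = 1 ∧ AuctionState G φ (cells n 3 s) v s') ∨
      (s'.reg 4 = 0 ∧ s'.reg 7 = 0 ∧ ∃ X, Violated G φ (cells n 3 s) X))
    (fun s' => ∑ w : Fin n, (n + 1 - s'.arr 5 w) + s'.reg 4) (.inl ⟨r4, h⟩) ?_ ?_) ?_ ?_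
  · rw [r4]
    refine Nat.add_le_add_right ((Finset.sum_le_card_nsmul _ _ (n + 1) fun w _ => by omega).trans
      (by simp)) 1
  · rintro s' hf' (⟨h4', ha⟩ | ⟨-, h7, -⟩) he
    · refine (runs_auctionStep (hin₁.frame hf' (by decide) (by decide))
        ((hf'.reg 5 (by decide)).trans r5) hvT he ha).imp ?_
      rintro s'' - (⟨h4'', ha', hlt⟩ | ⟨h4'', h7, hX, h5⟩)
      · exact ⟨.inl ⟨h4''.trans h4', ha'⟩, by omega⟩
      · refine ⟨.inr ⟨h4'', h7, hX⟩, ?_⟩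
        rw [h5]; omega
    · exact absurd h7 he
  · rw [Nat.add_sub_cancel_left]
    exact le_rfl
  · rintro s' - ⟨⟨h4', own, cur, -, -, ha⟩ | ⟨h4', -, hX⟩, he⟩
    · simp only [Expr.eval] at he
      rw [he] at ha
      exact .inl ⟨h4', ha.hasDisjointPaths⟩
    · exact .inr ⟨h4', hX⟩

/-! ### Testing connectivity and extracting a minimal violated set -/

/-- The negative answer comes with a violated set, not merely missing paths: this is the hard half
of Menger in the form the greedy algorithm needs. -/
theorem runs_check (hin : Input G φ s) :
    Runs check s (checkTime n) fun s' =>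
      (s'.reg 4 = 1 ∧ IsVectorConnectivitySet G φ (cells n 3 s)) ∨
      (s'.reg 4 = 0 ∧ ∃ X, Violated G φ (cells n 3 s) X) := by
  unfold checkTime
  refine Runs.assign_seq <| Runs.mono (Runs.forRange (n := n) (B := 10 + auctionTime n)
    (fun i s' => (s'.reg 4 = 1 ∧ ∀ v : Fin n, v < i → v ∉ cells n 3 s →
        HasDisjointPaths G v (cells n 3 s) (φ v)) ∨
      (s'.reg 4 = 0 ∧ ∃ X, Violated G φ (cells n 3 s) X))
    (by simp [hin.size]) (by decide) (by decide) (by decide) (fun i s' c h => by simpa using h)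
    (.inl ⟨by simp [Expr.eval], fun v hv => absurd hv (Nat.not_lt_zero _)⟩) ?_) ?_ ?_
  · intro i hi s' hf _ hx h
    have a3 : s'.arr 3 = s.arr 3 := hf.arr 3 (by decide)
    have hc : cells n 3 s' = cells n 3 s := cells_congr a3
    have hin' := (hin.setReg (x := 4) (by decide) 1).frame hf (by decide) (by decide)
    refine Runs.cond (fun he => Runs.skip ?_) fun he => Runs.cond (fun he' => ?_)
      fun he' => Runs.skip ?_
    · refine h.imp_left fun ⟨h4, h⟩ => ⟨h4, fun v hv hvT => ?_⟩
      rcases Nat.lt_succ_iff_lt_or_eq.1 hv with hv | hv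
      · exact h v hv hvT
      · rw [mem_cells] at hvT
        simp only [Expr.eval, hx, a3, ← hv] at he
        exact absurd he hvT
    · rcases h with ⟨h4, h⟩ | ⟨h4, -⟩
      · have hiT : (⟨i, hi⟩ : Fin n) ∉ cells n 3 s' := by
          rw [mem_cells]
          simpa [Expr.eval, hx] using he
        refine (runs_auction hin' (v := ⟨i, hi⟩) hx h4 hiT).mono
          (by simp only [Expr.cost]; omega) ?_
        rintro s'' - h'
        rw [hc] at h'
        refine h'.imp_left fun ⟨h4, h'⟩ => ⟨h4, fun v hv hvT => ?_⟩
        rcases Nat.lt_succ_iff_lt_or_eq.1 hv with hv | hv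
        · exact h v hv hvT
        · obtain rfl : v = ⟨i, hi⟩ := Fin.ext hv
          exact h'
      · exact absurd h4 he'
    · rcases h with ⟨h4, -⟩ | h
      · simp [Expr.eval, h4] at he'
      · exact .inr h
  · simp only [Expr.cost]
    rw [show 10 + auctionTime n + 8 = 18 + auctionTime n by omega]
    have : (n + 1) * (18 + auctionTime n) ≤ (n + 1) * (20 + auctionTime n) :=
      Nat.mul_le_mul_left _ (by omega)
    omega
  · rintro s' - h
    exact h.imp_left fun ⟨h4, h⟩ => ⟨h4, fun v hv => h v v.2 hv⟩

theorem runs_maximalize (hin : Input G φ s) (hX : ∃ X, Violated G φ (cells n 3 s) X) :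
    Runs maximalize s (maximalizeTime n) fun s' => cells n 3 s ⊆ cells n 3 s' ∧
      (∃ X, Violated G φ (cells n 3 s') X) ∧
      ∀ j, j ∉ cells n 3 s' → ∀ Y, ¬ Violated G φ (insert j (cells n 3 s')) Y := by
  unfold maximalizeTime
  refine Runs.mono (Runs.forRange (n := n) (B := 30 + checkTime n)
    (fun i s' => cells n 3 s ⊆ cells n 3 s' ∧ (∃ X, Violated G φ (cells n 3 s') X) ∧
      ∀ j : Fin n, j < i → j ∉ cells n 3 s' → ∀ Y, ¬ Violated G φ (insert j (cells n 3 s')) Y)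
    hin.size (by decide) (by decide) (by decide) (fun i s' c h => h)
    ⟨subset_rfl, hX, fun j hj => absurd hj (Nat.not_lt_zero _)⟩ ?_) ?_ ?_
  · rintro i hi s₁ hf - hx ⟨hsub, hX₁, hmax⟩
    have hin₁ := hin.frame hf (by decide) (by decide)
    refine Runs.store_seq ?_
    simp only [Expr.eval, hx]
    set s₂ := s₁.setArr 3 i 1 with hs₂
    have hc₂ : cells n 3 s₂ = insert ⟨i, hi⟩ (cells n 3 s₁) := by
      ext w
      simp only [mem_cells, Finset.mem_insert, hs₂, setArr_arr, if_true, Function.update_apply,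
        Fin.ext_iff]
      split_ifs with hw <;> simp [hw]
    refine Runs.seq ((runs_check (hin₁.setArr (a := 3) (by decide) i 1)).imp ?_)
      (by simp only [Expr.cost]; omega)
    intro s₃ hf₃ h
    have a3 := hf₃.arr 3 (by decide)
    have x3 : s₃.reg 14 = i := (hf₃.reg 14 (by decide)).trans hx
    have hc₃ : cells n 3 s₃ = insert ⟨i, hi⟩ (cells n 3 s₁) := (cells_congr a3).trans hc₂
    rw [← hs₂, hc₂] at h
    refine Runs.cond (fun he => ?_) (fun he => ?_) (by simp only [Expr.cost]; omega)
    · rcases h with ⟨-, hvcs⟩ | ⟨h4, -⟩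
      -- A vertex already in `T` is never rejected, since `T` still has a violated set; so resetting
      -- its cell to 0 restores `T`.
      · have hi₁ : (⟨i, hi⟩ : Fin n) ∉ cells n 3 s₁ := fun hmem => by
          rw [Finset.insert_eq_of_mem hmem] at hvcs
          obtain ⟨X, hX⟩ := hX₁
          exact hvcs.not_violated X hX
        refine Runs.store ?_ (by simp only [Expr.cost]; omega)
        have hc₄ : cells n 3 (s₃.setArr 3 (Expr.eval s₃ (.var 14)) (Expr.eval s₃ (.const 0))) =
            cells n 3 s₁ := by
          ext w
          rw [mem_cells]
          simp only [Expr.eval, x3, setArr_arr, if_true, Function.update_apply]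
          split_ifs with hw
          · have : w = ⟨i, hi⟩ := Fin.ext hw
            simp [this, hi₁]
          · rw [← mem_cells, hc₃, Finset.mem_insert]
            simp [Fin.ext_iff, hw]
        rw [hc₄]
        refine ⟨hsub, hX₁, fun j hj hjT => ?_⟩
        rcases Nat.lt_succ_iff_lt_or_eq.1 hj with hj | hj
        · exact hmax j hj hjT
        · obtain rfl : j = ⟨i, hi⟩ := Fin.ext hj
          exact hvcs.not_violated
      · exact absurd h4 he
    · rcases h with ⟨h4, -⟩ | ⟨-, hX₃⟩
      · simp [Expr.eval, h4] at he
      · refine Runs.skip ?_ (by simp only [Expr.cost]; omega)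
        rw [hc₃]
        refine ⟨hsub.trans (Finset.subset_insert _ _), hX₃, fun j hj hjT Y hY => ?_⟩
        rw [Finset.mem_insert, not_or] at hjT
        rcases Nat.lt_succ_iff_lt_or_eq.1 hj with hj | hj
        -- One pass suffices: a vertex once rejected stays rejected as `T` grows.
        · exact hmax j hj hjT.2 Y
            (hY.anti (Finset.insert_subset_insert _ (Finset.subset_insert _ _)))
        · exact hjT.1 (Fin.ext hj)
  · have : (n + 1) * (30 + checkTime n + 8) ≤ (n + 1) * (40 + checkTime n) :=
      Nat.mul_le_mul_left _ (by omega)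
    omega
  · rintro s' - ⟨h₁, h₂, h₃⟩
    exact ⟨h₁, h₂, fun j hj => h₃ j j.2 hj⟩

theorem runs_addNeighbors (hin : Input G φ s) {u : Fin n} (hu : s.reg 15 = u) :
    Runs addNeighbors s (addNeighborsTime n) fun s' => ∀ w : Fin n,
      s'.arr 2 w ≠ 0 ↔ s.arr 2 w ≠ 0 ∨ G.Adj u w ∧ s.arr 3 w ≠ 0 := by
  unfold addNeighborsTime
  refine Runs.assign_seq <| Runs.mono (Runs.forRange (n := n) (B := 20)
    (fun i s' => ∀ w : Fin n,
      s'.arr 2 w ≠ 0 ↔ s.arr 2 w ≠ 0 ∨ w < i ∧ G.Adj u w ∧ s.arr 3 w ≠ 0)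
    (by simp [hin.size]) (by decide) (by decide) (by decide) (fun i s' c h => h)
    (fun w => by simp) ?_) (by simp only [Expr.cost]; omega) ?_
  · intro i hi s' hf _ hx h
    have a0 : s'.arr 0 = s.arr 0 := hf.arr 0 (by decide)
    have a3 : s'.arr 3 = s.arr 3 := hf.arr 3 (by decide)
    have r18 := hf.reg 18 (by decide)
    simp only [setReg_reg, if_true, Expr.eval, hu] at r18
    rw [hin.row] at r18
    have hadj := hin.adj u ⟨i, hi⟩
    refine Runs.cond (fun he => ?_) fun he => ?_
    · simp only [Expr.eval, a0, r18, hx] at he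
      refine Runs.store fun w => ?_
      have hw := h w
      simp only [Expr.eval, hx, setArr_arr, if_true, Function.update_apply, a3]
      split_ifs with hwi
      · have : w = ⟨i, hi⟩ := Fin.ext hwi
        subst this
        have := hadj.1 he
        simp only [lt_irrefl, false_and, or_false] at hw
        simp only [Nat.lt_succ_self, true_and, this]
        rw [← hw]
        omega
      · rw [hw, Nat.lt_succ_iff_lt_or_eq]
        simp [hwi]
    · simp only [Expr.eval, a0, r18, hx] at he
      refine Runs.skip fun w => ?_
      rw [h w, Nat.lt_succ_iff_lt_or_eq]
      by_cases hwi : (w : ℕ) = i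
      · have : w = ⟨i, hi⟩ := Fin.ext hwi
        subst this
        have : ¬ G.Adj u ⟨i, hi⟩ := fun hadj' => hadj.2 hadj' he
        simp [this]
      · simp [hwi]
  · intro s' _ h w
    simpa using h w

theorem runs_grow (hin : Input G φ s)
    (hne : ((cells n 3 s)ᶜ).Nonempty) :
    Runs grow s (growTime n) fun s' => ∃ x ∈ (cells n 3 s)ᶜ,
      cells n 2 s' = insert x (cells n 2 s ∪ boundary G (cells n 3 s)ᶜ) := by
  unfold growTime
  refine Runs.seq (B₁ := 2 + (n + 1) * (10 + addNeighborsTime n + 8))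
    (Runs.imp (Runs.forRange (n := n)
    (fun i s' => (∀ w : Fin n, s'.arr 2 w ≠ 0 ↔ s.arr 2 w ≠ 0 ∨
        s.arr 3 w ≠ 0 ∧ ∃ j : Fin n, j < i ∧ s.arr 3 j = 0 ∧ G.Adj j w) ∧
      ((∃ j : Fin n, j < i ∧ s.arr 3 j = 0) → ∃ x : Fin n, s.arr 3 x = 0 ∧ s'.reg 15 = x))
    hin.size (by decide) (by decide) (by decide) (fun i s' c h => by simpa using h)
    ⟨fun w => by simp, by simp⟩ ?_) ?_) ?_
  · rintro i hi s' hf - hx ⟨h₁, h₂⟩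
    have a3 : s'.arr 3 = s.arr 3 := hf.arr 3 (by decide)
    have hin' := hin.frame hf (by decide) (by decide)
    refine Runs.cond (fun he => ?_) (fun he => ?_) (by simp only [Expr.cost]; omega)
    · simp only [Expr.eval, hx, a3] at he
      have hex : ∀ Q : Fin n → Prop, (∃ j : Fin n, (j : ℕ) < i + 1 ∧ s.arr 3 j = 0 ∧ Q j) ↔
          ∃ j : Fin n, (j : ℕ) < i ∧ s.arr 3 j = 0 ∧ Q j := fun Q => by
        refine exists_congr fun j => ?_
        rw [Nat.lt_succ_iff_lt_or_eq]
        refine ⟨fun ⟨hj, h, hQ⟩ => ⟨hj.resolve_right fun h' => he (h' ▸ h), h, hQ⟩,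
          fun ⟨hj, h⟩ => ⟨.inl hj, h⟩⟩
      refine Runs.skip ⟨fun w => ?_, ?_⟩ (by simp only [Expr.cost]; omega)
      · rw [hex, h₁ w]
      · have := hex fun _ => True
        simp only [and_true] at this
        rwa [this]
    · simp only [Expr.eval, hx, a3] at he
      refine Runs.assign_seq (Runs.mono (runs_addNeighbors (u := ⟨i, hi⟩)
        (hin'.setReg (by decide) _) ?_) ?_ ?_) (by simp only [Expr.cost]; omega)
      · simp [Expr.eval, hx]
      · simp only [Expr.cost]; omega
      · intro s'' hf' h
        have r15 := hf'.reg 15 (by decide)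
        simp only [setReg_reg, if_true, Expr.eval, hx] at r15
        simp only [setReg_arr, a3] at h
        refine ⟨fun w => ?_, fun _ => ⟨⟨i, hi⟩, he, r15⟩⟩
        rw [h w, h₁ w]
        constructor
        · rintro ((h | ⟨h, j, hj, h'⟩) | ⟨h, h'⟩)
          · exact .inl h
          · exact .inr ⟨h, j, by omega, h'⟩
          · exact .inr ⟨h', ⟨i, hi⟩, Nat.lt_succ_self _, he, h⟩
        · rintro (h | ⟨h, j, hj, h'⟩)
          · exact .inl (.inl h)
          · rcases Nat.lt_succ_iff_lt_or_eq.1 hj with hj | hj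
            · exact .inl (.inr ⟨h, j, hj, h'⟩)
            · obtain rfl : j = ⟨i, hi⟩ := Fin.ext hj
              exact .inr ⟨h'.2, h⟩
  · rintro s' hf ⟨h₁, h₂⟩
    obtain ⟨j, hj⟩ := hne
    have hT : ∀ w : Fin n, w ∈ (cells n 3 s)ᶜ ↔ s.arr 3 w = 0 := fun w => by simp [mem_cells]
    -- The vertex left in register 15 by the loop lies outside `T` and serves as the extra vertex.
    obtain ⟨x, hx, hx15⟩ := h₂ ⟨j, j.2, (hT j).1 hj⟩
    refine Runs.store ⟨x, (hT x).2 hx, ?_⟩ ?_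
    · ext w
      simp only [mem_cells, Expr.eval, hx15, setArr_arr, if_true, Function.update_apply,
        Finset.mem_insert, Finset.mem_union, mem_boundary, hT]
      by_cases hw : w = x
      · simp [hw]
      · have : ¬ (w : ℕ) = x := fun h => hw (Fin.ext h)
        rw [if_neg this, h₁ w]
        simp [hw]
    · have : (n + 1) * (10 + addNeighborsTime n + 8) ≤ (n + 1) * (20 + addNeighborsTime n) :=
        Nat.mul_le_mul_left _ (by omega)
      simp only [Expr.cost]
      omega
  · have : (n + 1) * (10 + addNeighborsTime n + 8) ≤ (n + 1) * (20 + addNeighborsTime n) :=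
      Nat.mul_le_mul_left _ (by omega)
    omega

/-! ### The greedy algorithm for fixed `k` -/

/-- The loop invariant of the greedy algorithm. -/
def GreedyState (G : SimpleGraph (Fin n)) (φ : Fin n → ℕ) (k : ℕ) (s : State) : Prop :=
  (∃ D, Greedy G φ k (cells n 2 s) (s.reg 3) D) ∧
    (s.reg 4 = 0 ∨ s.reg 4 = 1 ∧ IsVectorConnectivitySet G φ (cells n 2 s))

theorem runs_greedyStep (hin : Input G φ s) {k : ℕ} (h : GreedyState G φ k s) (h4 : s.reg 4 = 0) :
    Runs greedyStep s (greedyStepTime n) fun s' => GreedyState G φ k s' ∧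
      n + 1 - (cells n 2 s').card - s'.reg 4 < n + 1 - (cells n 2 s).card - s.reg 4 := by
  unfold greedyStepTime
  obtain ⟨⟨D, hg⟩, -⟩ := h
  have hcard : ∀ s : State, (cells n 2 s).card ≤ n := fun s => by
    simpa using Finset.card_le_univ (cells n 2 s)
  refine Runs.seq (B₁ := 2 + (n + 1) * (20 + 8)) (Runs.imp (Runs.forRange (n := n)
    (fun i s' => ∀ w : Fin n, w < i → s'.arr 3 w = s.arr 2 w)
    hin.size (by decide) (by decide) (by decide) (fun i s' c h => h)
    (fun w hw => absurd hw (Nat.not_lt_zero _)) ?_) ?_) (by omega)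
  · intro i hi s' hf _ hx h
    have a2 := hf.arr 2 (by decide)
    refine Runs.store fun w hw => ?_
    simp only [Expr.eval, hx, setArr_arr, if_true, Function.update_apply, a2]
    split_ifs with hwi
    · rw [hwi]
    · exact h w (by omega)
  intro s₁ hf₁ hcopy
  have hin₁ := hin.frame hf₁ (by decide) (by decide)
  have c₁ : cells n 3 s₁ = cells n 2 s := by
    ext w; rw [mem_cells, mem_cells, hcopy w w.2]
  refine Runs.seq ((runs_check hin₁).imp fun s₂ hf₂ hchk => ?_) (by omega)
  have hin₂ := hin₁.frame hf₂ (by decide) (by decide)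
  have c₂ : cells n 3 s₂ = cells n 2 s := (cells_congr (hf₂.arr 3 (by decide))).trans c₁
  have d₂ : cells n 2 s₂ = cells n 2 s :=
    cells_congr ((hf₂.arr 2 (by decide)).trans (hf₁.arr 2 (by decide)))
  have m₂ : s₂.reg 3 = s.reg 3 := (hf₂.reg 3 (by decide)).trans (hf₁.reg 3 (by decide))
  rw [c₁] at hchk
  refine Runs.cond (fun he => ?_) (fun he => ?_) (by simp only [Expr.cost]; omega)
  · refine Runs.skip ?_ (by simp only [Expr.cost]; omega)
    rcases hchk with ⟨r4, hvcs⟩ | ⟨r4, -⟩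
    · have := hcard s
      exact ⟨⟨⟨D, by rwa [d₂, m₂]⟩, .inr ⟨r4, by rwa [d₂]⟩⟩, by rw [d₂, r4, h4]; omega⟩
    · exact absurd r4 he
  · rcases hchk with ⟨r4, -⟩ | ⟨-, hX⟩
    · simp [Expr.eval, r4] at he
    rw [← c₂] at hX
    refine Runs.seq ((runs_maximalize hin₂ hX).imp ?_) (by simp only [Expr.cost]; omega)
    rintro s₃ hf₃ ⟨hsub, ⟨X, hX⟩, hmax⟩
    have hin₃ := hin₂.frame hf₃ (by decide) (by decide)
    have d₃ : cells n 2 s₃ = cells n 2 s := (cells_congr (hf₃.arr 2 (by decide))).trans d₂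
    have m₃ : s₃.reg 3 = s.reg 3 := (hf₃.reg 3 (by decide)).trans m₂
    obtain ⟨hviol, hmin⟩ := violated_compl_of_maximal hX hmax
    rw [c₂] at hsub
    refine Runs.seq ((runs_grow hin₃ (by obtain ⟨v, hv, -⟩ := hviol.2; exact ⟨v, hv⟩)).imp
      ?_) (by simp only [Expr.cost]; omega)
    rintro s₄ hf₄ ⟨x, hx, hc₄⟩
    have m₄ : s₄.reg 3 = s.reg 3 := (hf₄.reg 3 (by decide)).trans m₃
    rw [d₃] at hc₄
    refine Runs.assign_seq (Runs.assign ?_ (by simp only [Expr.cost]; omega))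
      (by simp only [Expr.cost]; omega)
    -- The complement of `T` is minimal among the sets violated for `T`; the greedy step needs this
    -- for the smaller set `S`, which `hmin` covers.
    have hg' := hg.step (hviol.anti hsub) (hmin (cells n 2 s)) hx
    have e : ∀ a b, cells n 2 ((s₄.setReg 3 a).setReg 4 b) = cells n 2 s₄ := fun _ _ => rfl
    refine ⟨⟨⟨D ∪ (cells n 3 s₃)ᶜ, ?_⟩, .inl (by simp [Expr.eval])⟩, ?_⟩
    · rw [e, hc₄]
      simpa [Expr.eval, m₄] using hg'
    · have hlt : (cells n 2 s).card < (cells n 2 s₄).card := Finset.card_lt_card <| by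
        rw [hc₄, Finset.ssubset_iff]
        exact ⟨x, fun h' => (Finset.mem_compl.1 hx) (hsub h'),
          Finset.insert_subset_insert _ Finset.subset_union_left⟩
      have := hcard s₄
      rw [e]
      simp [Expr.eval]
      omega

theorem runs_greedyInit (hin : Input G φ s) {k : ℕ} (hk : s.reg 1 = k) :
    Runs greedyInit s (greedyInitTime n) (GreedyState G φ k) := by
  unfold greedyInitTime
  refine Runs.assign_seq <| Runs.assign_seq <| Runs.mono (Runs.forRange (n := n) (B := 20)
    (fun i s' => (∀ w : Fin n, w < i → (s'.arr 2 w ≠ 0 ↔ k < φ w)) ∧ s'.reg 4 = 0 ∧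
      s'.reg 3 = (Finset.univ.filter fun w : Fin n => w < i ∧ k < φ w).card)
    (by simp [hin.size]) (by decide) (by decide) (by decide) (fun i s' c h => by simpa using h)
    ⟨fun w hw => absurd hw (Nat.not_lt_zero _), by simp [Expr.eval], by simp [Expr.eval]⟩ ?_)
    (by simp only [Expr.cost]; omega) ?_
  · rintro i hi s' hf - hx ⟨h₁, h4, h3⟩
    have a1 : s'.arr 1 i = φ ⟨i, hi⟩ := by
      have : s'.arr 1 = s.arr 1 := hf.arr 1 (by decide)
      rw [this, ← hin.demand]
    have r1 : s'.reg 1 = k := by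
      rw [hf.reg 1 (by decide)]
      simpa using hk
    refine Runs.cond (fun he => ?_) fun he => ?_
    · simp only [Expr.eval, hx, a1, r1] at he
      refine Runs.store_seq <| Runs.assign ⟨fun w hw => ?_, by simpa using h4, ?_⟩
      · simp only [Expr.eval, hx, setReg_arr, setArr_arr, if_true, Function.update_apply]
        split_ifs with hwi
        · obtain rfl : w = ⟨i, hi⟩ := Fin.ext hwi
          simp; omega
        · exact h₁ w (by omega)
      · have : (Finset.univ.filter fun w : Fin n => w < i + 1 ∧ k < φ w) =
            insert ⟨i, hi⟩ (Finset.univ.filter fun w : Fin n => w < i ∧ k < φ w) := by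
          ext w
          simp only [Finset.mem_filter, Finset.mem_univ, true_and, Finset.mem_insert]
          rw [Nat.lt_succ_iff_lt_or_eq]
          constructor
          · rintro ⟨h | h, h'⟩
            · exact .inr ⟨h, h'⟩
            · exact .inl (Fin.ext h)
          · rintro (rfl | ⟨h, h'⟩)
            · exact ⟨.inr rfl, by omega⟩
            · exact ⟨.inl h, h'⟩
        rw [this, Finset.card_insert_of_notMem (by simp)]
        simp [Expr.eval, h3]
    · simp only [Expr.eval, hx, a1, r1] at he
      refine Runs.store ⟨fun w hw => ?_, by simpa using h4, ?_⟩
      · simp only [Expr.eval, hx, setArr_arr, if_true, Function.update_apply]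
        split_ifs with hwi
        · obtain rfl : w = ⟨i, hi⟩ := Fin.ext hwi
          simp; omega
        · exact h₁ w (by omega)
      · have : ∀ w : Fin n, ((w : ℕ) < i + 1 ∧ k < φ w) ↔ ((w : ℕ) < i ∧ k < φ w) := fun w => by
          rw [Nat.lt_succ_iff_lt_or_eq]
          refine ⟨fun ⟨h, h'⟩ => ⟨h.resolve_right fun hw => ?_, h'⟩, fun ⟨h, h'⟩ => ⟨.inl h, h'⟩⟩
          obtain rfl : w = ⟨i, hi⟩ := Fin.ext hw
          omega
        simp only [this, setArr_reg, h3]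
  · rintro s' - ⟨h₁, h4, h3⟩
    have hmem : ∀ w, w ∈ cells n 2 s' ↔ k < φ w := fun w => by rw [mem_cells, h₁ w w.2]
    have hg := Greedy.init G φ k (cells n 2 s') hmem
    refine ⟨⟨cells n 2 s', ?_⟩, .inl h4⟩
    convert hg using 1
    rw [h3]
    congr 1
    ext w
    simp [hmem]

theorem runs_greedy (hin : Input G φ s) {k : ℕ} (hk : s.reg 1 = k) :
    Runs greedy s (greedyTime n) fun s' => (∃ D, Greedy G φ k (cells n 2 s') (s'.reg 3) D) ∧
      IsVectorConnectivitySet G φ (cells n 2 s') := by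
  unfold greedyTime
  refine Runs.seq ((runs_greedyInit hin hk).imp fun s₁ hf h => ?_)
  have hin₁ := hin.frame hf (by decide) (by decide)
  refine Runs.mono (Runs.loop (B := greedyStepTime n) (N := n + 1) (GreedyState G φ k)
    (fun s' => n + 1 - (cells n 2 s').card - s'.reg 4) h (by omega) ?_) ?_ ?_
  · intro s' hf' h' he
    have : s'.reg 4 = 0 := by simp [Expr.eval] at he; omega
    exact runs_greedyStep (hin₁.frame hf' (by decide) (by decide)) h' this
  · rw [Nat.add_sub_cancel_left]
    exact le_rfl
  · rintro s' - ⟨⟨hD, h4 | ⟨-, hvcs⟩⟩, he⟩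
    · simp [Expr.eval, h4] at he
    · exact ⟨hD, hvcs⟩

/-! ### The search for `k` -/

theorem opt_le (G : SimpleGraph (Fin n)) (φ : Fin n → ℕ) : opt G φ ≤ n :=
  Nat.sInf_le ⟨Finset.univ, isVectorConnectivitySet_univ G φ, by simp⟩

theorem inputState_adj (G : SimpleGraph (Fin n)) (φ : Fin n → ℕ) (u v : Fin n) :
    (inputState G φ).arr 0 (u * n + v) ≠ 0 ↔ G.Adj u v := by
  simp only [inputState, if_true, ne_eq, ite_eq_right_iff, one_ne_zero, imp_false, not_not]
  refine ⟨?_, fun h => ⟨u, v, rfl, h⟩⟩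
  rintro ⟨u', v', he, h⟩
  have hn : 0 < n := u.pos
  have h₁ := congrArg (· / n) he
  have h₂ := congrArg (· % n) he
  simp only [Nat.mod_eq_of_lt v.2,
    Nat.mod_eq_of_lt v'.2, mul_comm _ n, Nat.mul_add_mod, Nat.mul_add_div hn,
    Nat.div_eq_of_lt v.2, Nat.div_eq_of_lt v'.2, add_zero] at h₁ h₂
  rwa [Fin.ext h₁, Fin.ext h₂]

/-- The machine cannot multiply, so the row offsets are tabulated by repeated addition. -/
theorem runs_rows (G : SimpleGraph (Fin n)) (φ : Fin n → ℕ) :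
    Runs rows (inputState G φ) (10 + (n + 1) * 40) (Input G φ) := by
  refine Runs.assign_seq <| Runs.mono (Runs.forRange (n := n) (B := 20)
    (fun i s' => s'.reg 20 = i * n ∧ ∀ u : Fin n, u < i → s'.arr 6 u = u * n)
    (by simp [inputState]) (by decide) (by decide) (by decide) (fun i s' c h => by simpa using h)
    ⟨by simp [Expr.eval], fun w hw => absurd hw (Nat.not_lt_zero _)⟩ ?_)
    (by simp only [Expr.cost]; omega) ?_
  · rintro i hi s' - h0 hx ⟨h₁, h₂⟩
    refine Runs.store_seq <| Runs.assign ⟨?_, fun u hu => ?_⟩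
    · simp [Expr.eval, h₁, h0, add_mul]
    · simp only [Expr.eval, hx, setReg_arr, setArr_arr, if_true, Function.update_apply]
      split_ifs with hui
      · rw [h₁, hui]
      · exact h₂ u (by omega)
  · rintro s' hf ⟨-, h⟩
    have a0 : s'.arr 0 = (inputState G φ).arr 0 := hf.arr 0 (by decide)
    have a1 : s'.arr 1 = (inputState G φ).arr 1 := hf.arr 1 (by decide)
    refine ⟨(hf.reg 0 (by decide)).trans (by simp [inputState]), fun u v => ?_, fun v => ?_,
      fun u => h u u.2⟩
    · rw [a0, inputState_adj]
    · rw [a1]; simp [inputState]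

theorem runs_approximation (G : SimpleGraph (Fin n)) (φ : Fin n → ℕ) :
    Runs approximation (inputState G φ) (approximationTime n) fun s' =>
      IsVectorConnectivitySet G φ (outputSet n s') ∧ (outputSet n s').card ≤ opt G φ ^ 2 := by
  unfold approximationTime
  refine Runs.seq ((runs_rows G φ).imp fun s hf hin => ?_) (by omega)
  refine Runs.assign_seq (Runs.assign_seq (Runs.mono (Runs.loop (B := 20 + greedyTime n)
    (N := n + 1) (fun s' => s'.reg 1 ≤ opt G φ ∧ (s'.reg 2 = 1 ∨ s'.reg 2 = 0 ∧
      IsVectorConnectivitySet G φ (cells n 2 s') ∧ (cells n 2 s').card ≤ s'.reg 1 ^ 2))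
    (fun s' => n - s'.reg 1 + s'.reg 2) ⟨by simp [Expr.eval], by simp [Expr.eval]⟩
    (by simp [Expr.eval]) ?_) ?_ ?_) ?_) ?_
  · rintro s₁ hf₁ ⟨hk, h2 | ⟨h2, -⟩⟩ he
    · have hin₁ := ((hin.setReg (x := 1) (by decide) 0).setReg (x := 2) (by decide) 1).frame hf₁
        (by decide) (by decide)
      refine Runs.seq ((runs_greedy hin₁ rfl).imp ?_) (by omega)
      rintro s₂ hf₂ ⟨⟨D, hg⟩, hvcs⟩
      have r1 := hf₂.reg 1 (by decide)
      have r2 := (hf₂.reg 2 (by decide)).trans h2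
      refine Runs.cond (fun he' => ?_) (fun he' => ?_) (by simp only [Expr.cost]; omega)
      · simp only [Expr.eval, r1] at he'
        -- Failure for `k` certifies `k < opt`; this preserves the invariant and, with `opt ≤ n`,
        -- makes the variant drop.
        have hlt := hg.lt_opt (by omega)
        have := opt_le G φ
        refine Runs.assign ⟨⟨?_, .inl ?_⟩, ?_⟩ (by simp only [Expr.cost]; omega)
        · simp [Expr.eval, r1]; omega
        · simpa using r2
        · simp [Expr.eval, r1, r2, h2]; omega
      · simp only [Expr.eval, r1] at he'
        refine Runs.assign ⟨⟨?_, .inr ⟨?_, hvcs, ?_⟩⟩, ?_⟩ (by simp only [Expr.cost]; omega)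
        · simpa [r1] using hk
        · simp [Expr.eval]
        · rw [setReg_reg, if_neg (by decide), r1]
          exact hg.card_le_sq (by omega)
        · simp [Expr.eval, r1, h2]
    · exact absurd h2 he
  · rw [show (Expr.var 2).cost + 1 = 2 from rfl, show n + 1 + 1 = n + 2 from rfl]
    simp only [Expr.cost]
    omega
  · rintro s' - ⟨⟨hk, h2 | ⟨-, hvcs, hc⟩⟩, he⟩
    · simp [Expr.eval, h2] at he
    · exact ⟨hvcs, hc.trans (Nat.pow_le_pow_left hk 2)⟩
  · simp only [Expr.cost]
    omega
  · simp only [Expr.cost]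
    omega

/-! ### The polynomial bound -/

/-- The time bounds are defined over any commutative semiring, so that the same expression at
`Polynomial.X` supplies the required polynomial. -/
theorem eval_approximationTime (a : ℕ) :
    (approximationTime (Polynomial.X : Polynomial ℕ)).eval a = approximationTime a := by
  simp [approximationTime, greedyTime, greedyStepTime, greedyInitTime, growTime,
    addNeighborsTime, maximalizeTime, checkTime, auctionTime, auctionInitTime, auctionStepTime,
    scanTime]

theorem approximationTime_mono {a b : ℕ} (h : a ≤ b) :
    approximationTime a ≤ approximationTime b := by
  unfold approximationTime greedyTime greedyStepTime greedyInitTime growTime addNeighborsTime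
    maximalizeTime checkTime auctionTime auctionInitTime auctionStepTime scanTime
  gcongr

end Correctness
end VectorConn

theorem mainTheorem2 :
    ∃ (prog : VectorConn.Prog) (p : Polynomial ℕ),
      ∀ (n : ℕ) (G : SimpleGraph (Fin n)) (φ : Fin n → ℕ),
        ∃ (t : ℕ) (s : VectorConn.State),
          VectorConn.Exec prog (VectorConn.inputState G φ) t s ∧
          t ≤ p.eval (VectorConn.inputSize φ) ∧
          VectorConn.IsVectorConnectivitySet G φ (VectorConn.outputSet n s) ∧
          (VectorConn.outputSet n s).card ≤ VectorConn.opt G φ ^ 2 := by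
  refine ⟨VectorConn.approximation, VectorConn.approximationTime Polynomial.X, fun n G φ => ?_⟩
  obtain ⟨t, s, he, ht, hs⟩ := VectorConn.runs_approximation G φ
  refine ⟨t, s, he, ht.trans ?_, hs⟩
  rw [VectorConn.eval_approximationTime]
  -- The time bound involves only `n`, and `n ≤ n * n` is already covered by the adjacency matrix.
  exact VectorConn.approximationTime_mono ((Nat.le_mul_self n).trans (Nat.le_add_right _ _))
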